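/- **Setting.** Let $(X,d)$ be a bounded metric space and $\mu$ a non-negative Borel measure on $X$ with $0<\mu(B(x,r))<\infty$ for every open ball of radius $r\in(0,\infty)$. An *exponent* is a measurable $q:X\to(0,\infty]$ with $q^-:=\operatorname{ess\,inf}q>0$; we write $q^+:=\operatorname{ess\,sup}q$, $\mathcal P(X)$ for the set of exponents, and $\mathcal P_b^{\log}(X)$ for the exponents $p$ with $p^+<\infty$ such that $|1/p(x)-1/p(y)|\le C/\log(e+1/d(x,y))$ for all $x,y\in X$ and some constant $C$. For bounded functions, $f\gg h$ (or $h\ll f$) means $\operatorname{ess\,inf}(f-h)>0$. Put $\rho_{p(\cdot)}(f)=\int_X|f(x)|^{p(x)}d\mu(x)$ and $\|f\|_{L^{p(\cdot)}}=\inf\{\lambda>0:\rho_{p(\cdot)}(f/\lambda)\le1\}$, and let $L^{p(\cdot)}$ be the set of measurable $f$ with $\rho_{p(\cdot)}(f)<\infty$. For a sequence $g=(g_k)_{k\in\mathbb Z}$ in $L^{p(\cdot)}$ put (with $\lambda^{1/\infty}=1$, $\inf\emptyset=\infty$) $$\rho_{\ell^{q(\cdot)}(L^{p(\cdot)})}(g)=\sum_{k\in\mathbb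 Z}\inf\{\lambda_k>0:\rho_{p(\cdot)}(g_k/\lambda_k^{1/q(\cdot)})\le1\},\qquad \|g\|_{\ell^{q(\cdot)}(L^{p(\cdot)})}=\inf\{\lambda>0:\rho_{\ell^{q(\cdot)}(L^{p(\cdot)})}(g/\lambda)\le1\},$$ and let $\ell^{q(\cdot)}(L^{p(\cdot)})$ be the set of such $g$ with $\rho_{\ell^{q(\cdot)}(L^{p(\cdot)})}(g/\lambda)<\infty$ for some $\lambda>0$. For a measurable, a.e. finite $u:X\to[-\infty,\infty]$, let $\mathbb D^{s(\cdot)}(u)$ be the set of sequences $(g_k)_{k\in\mathbb Z}$ of non-negative measurable functions for which there is a null set $N$ such that $$|u(x)-u(y)|\le d(x,y)^{s(x)}g_k(x)+d(x,y)^{s(y)}g_k(y)$$ for all $k\in\mathbb Z$ and $x,y\in X\setminus N$ with $2^{-k-1}\le d(x,y)<2^{-k}$. The homogeneous Hajłasz–Besov space $\dot N^{s(\cdot)}_{p(\cdot),q(\cdot)}$ consists of all such $u$ with $\inf_{g\in\mathbb D^{s(\cdot)}(u)}\|g\|_{\ell^{q(\cdot)}(L^{p(\cdot)})}<\infty$,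 and $N^{s(\cdot)}_{p(\cdot),q(\cdot)}:=\dot N^{s(\cdot)}_{p(\cdot),q(\cdot)}\cap L^{p(\cdot)}$. **Theorem.** Let $Q\in\mathcal P_b^{\log}(X)$, $\delta\in(0,\infty)$ and $b\in(0,1]$ be such that $\mu(B(x,r))\ge b\,r^{Q(x)}$ for all $x\in X$ and $r\in(0,\delta]$. Let $p,s,\varepsilon\in\mathcal P_b^{\log}(X)$ with $\varepsilon\ll s$, and let $q\in\mathcal P(X)$ be arbitrary. All constants below are positive and depend only on $b$, $\delta$, $\operatorname{diam}X$ and the exponents $p,s,Q,\varepsilon$, and in (i) also on $\mu(X)$. They depend on the exponents only through a common positive lower bound, a common upper bound and a common log-Hölder constant (for the reciprocals) of $p,s,Q,\varepsilon$, and through a positive lower bound for $(s-\varepsilon)^-$ and, in (i) and (iii) respectively, for $(Q-\varepsilon p)^-$ and $(\varepsilon p-Q)^-$. In particular they do not depend on $q$, $u$, $g$. 1. (i) If $\varepsilon p\ll Q$ and $\gamma_\varepsilon:=\frac{Qp}{Q-\varepsilon p}$, then there is a constant $C_S$ such that for all $u\in\dot N^{s(\cdot)}_{p(\cdot),q(\cdot)}$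 and $g\in\mathbb D^{s(\cdot)}(u)\cap\ell^{q(\cdot)}(L^{p(\cdot)})$, $$\inf_{c\in\mathbb R}\|u-c\|_{L^{\gamma_\varepsilon(\cdot)}}\le C_S\|g\|_{\ell^{q(\cdot)}(L^{p(\cdot)})},$$ and for all $u\in N^{s(\cdot)}_{p(\cdot),q(\cdot)}$ and $g\in\mathbb D^{s(\cdot)}(u)\cap\ell^{q(\cdot)}(L^{p(\cdot)})$, $$\|u\|_{L^{\gamma_\varepsilon(\cdot)}}\le C_S\big(\|u\|_{L^{p(\cdot)}}+\|g\|_{\ell^{q(\cdot)}(L^{p(\cdot)})}\big).$$ 2. (ii) If $\varepsilon p=Q$, then there are constants $C_{MT1},C_{MT2}$ such that for all $u\in\dot N^{s(\cdot)}_{p(\cdot),q(\cdot)}$ and $g\in\mathbb D^{s(\cdot)}(u)\cap\ell^{q(\cdot)}(L^{p(\cdot)})$ with $\|g\|_{\ell^{q(\cdot)}(L^{p(\cdot)})}>0$, the function $u$ is integrable and, with $u_X:=\frac1{\mu(X)}\int_X u\,d\mu$, $$\frac1{\mu(X)}\int_X\exp\Big(C_{MT1}\frac{|u(x)-u_X|}{\|g\|_{\ell^{q(\cdot)}(L^{p(\cdot)})}}\Big)d\mu(x)\le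 C_{MT2}.$$ 3. (iii) If $\varepsilon p\gg Q$ and $\alpha_\varepsilon:=\varepsilon-\frac Qp$, then there are constants $C_H,D_H$ such that for all $u\in\dot N^{s(\cdot)}_{p(\cdot),q(\cdot)}$ and $g\in\mathbb D^{s(\cdot)}(u)\cap\ell^{q(\cdot)}(L^{p(\cdot)})$, the function $u$ is integrable, $$\|u-u_X\|_{L^\infty}\le C_H\|g\|_{\ell^{q(\cdot)}(L^{p(\cdot)})},$$ and there is a continuous $\tilde u:X\to\mathbb R$ with $\tilde u=u$ a.e. and, for all $x,y\in X$, $$|\tilde u(x)-\tilde u(y)|\le D_H\|g\|_{\ell^{q(\cdot)}(L^{p(\cdot)})}\,d(x,y)^{\alpha_\varepsilon(x)}.$$ -/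

import Mathlib

open MeasureTheory Set
open scoped ENNReal NNReal

universe u

noncomputable section

namespace VarBesov

/-! ## Variable exponents -/

section Exponents

variable {X : Type u}

/-- `q` is a variable exponent on `X`: a measurable function `q : X → (0, ∞]` with
`q⁻ = ess inf q > 0`. -/
structure IsExponent [MeasurableSpace X] (μ : Measure X) (q : X → ℝ≥0∞) : Prop where
  measurable : Measurable q
  pos : ∀ x, 0 < q x
  essInf_pos : 0 < essInf q μ

/-- `f` is locally log-Hölder continuous on `X` with constant `L`:
`|f x - f y| ≤ L / log (e + 1 / d(x, y))`.
For `x = y` this reads `0 ≤ L`, whichever value is given to `1 / 0`. -/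
def LogHolderWith [MetricSpace X] (L : ℝ) (f : X → ℝ) : Prop :=
  ∀ x y, |f x - f y| ≤ L / Real.log (Real.exp 1 + 1 / dist x y)

/-- `p` is a bounded exponent whose reciprocal is locally log-Hölder continuous, with the
quantitative information `a ≤ p⁻`, `p⁺ ≤ A` and `C_log(1/p) ≤ L`. A positive function `p` belongs
to the class of bounded log-Hölder exponents iff this holds for some `a > 0`, `A` and `L`. -/
structure IsLogExponent [MetricSpace X] [MeasurableSpace X] (μ : Measure X) (a A L : ℝ)
    (p : X → ℝ) : Prop where
  measurable : Measurable p
  pos : ∀ x, 0 < p x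
  ess_lower : ∀ᵐ x ∂μ, a ≤ p x
  ess_upper : ∀ᵐ x ∂μ, p x ≤ A
  logHolder : LogHolderWith L (fun x => 1 / p x)

end Exponents

/-! ## Variable Lebesgue spaces and mixed Lebesgue sequence spaces

All quantities depend on a function only through its absolute value, so they are defined for
functions with values in `[0, ∞]`. Infima over the empty set are `∞`. -/

section Lebesgue

variable {X : Type u} [MeasurableSpace X]

/-- The semi-modular `ρ_{p(·)}(f) = ∫ f(x)^{p(x)} dμ(x)`. -/
def modular (μ : Measure X) (p : X → ℝ) (f : X → ℝ≥0∞) : ℝ≥0∞ :=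
  ∫⁻ x, f x ^ p x ∂μ

/-- The Luxemburg quasi-norm `inf {l ∈ (0, ∞) : ρ_{p(·)}(f / l) ≤ 1}`. -/
def luxNorm (μ : Measure X) (p : X → ℝ) (f : X → ℝ≥0∞) : ℝ≥0∞ :=
  ⨅ (l : ℝ) (_ : 0 < l) (_ : modular μ p (fun x => f x / ENNReal.ofReal l) ≤ 1),
    ENNReal.ofReal l

/-- Membership of `f` in `L^{p(·)}(X, μ)`. -/
def MemVarLp (μ : Measure X) (p : X → ℝ) (f : X → ℝ≥0∞) : Prop :=
  Measurable f ∧ modular μ p f < ∞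

/-- The semi-modular of `ℓ^{q(·)}(L^{p(·)})`:
`∑_{k ∈ ℤ} inf {l > 0 : ρ_{p(·)}(g_k / l^{1/q(·)}) ≤ 1}`, where `l^{1/∞} = 1`. -/
def mixedModular (μ : Measure X) (p : X → ℝ) (q : X → ℝ≥0∞) (g : ℤ → X → ℝ≥0∞) : ℝ≥0∞ :=
  ∑' k : ℤ, ⨅ (l : ℝ) (_ : 0 < l)
    (_ : modular μ p (fun x => g k x / ENNReal.ofReal (l ^ ((q x)⁻¹).toReal)) ≤ 1),
    ENNReal.ofReal l

/-- The quasi-norm of `ℓ^{q(·)}(L^{p(·)})`. -/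
def mixedNorm (μ : Measure X) (p : X → ℝ) (q : X → ℝ≥0∞) (g : ℤ → X → ℝ≥0∞) : ℝ≥0∞ :=
  ⨅ (l : ℝ) (_ : 0 < l)
    (_ : mixedModular μ p q (fun k x => g k x / ENNReal.ofReal l) ≤ 1),
    ENNReal.ofReal l

/-- Membership of a sequence in `ℓ^{q(·)}(L^{p(·)}(X, μ))`. -/
def MemMixed (μ : Measure X) (p : X → ℝ) (q : X → ℝ≥0∞) (g : ℤ → X → ℝ≥0∞) : Prop :=
  (∀ k, MemVarLp μ p (g k)) ∧
    ∃ l : ℝ, 0 < l ∧ mixedModular μ p q (fun k x => g k x / ENNReal.ofReal l) < ∞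

end Lebesgue

/-! ## Hajłasz–Besov spaces -/

section Besov

variable {X : Type u} [MetricSpace X] [MeasurableSpace X]

/-- Measurable functions `X → [-∞, ∞]` which are finite almost everywhere. -/
def MeasFiniteAE (μ : Measure X) (u : X → EReal) : Prop :=
  Measurable u ∧ ∀ᵐ x ∂μ, u x ≠ ⊤ ∧ u x ≠ ⊥

/-- `g = (g_k)_{k ∈ ℤ}` is a vector `s(·)`-gradient of `u`. -/
def IsVectorGradient (μ : Measure X) (s : X → ℝ) (u : X → EReal) (g : ℤ → X → ℝ≥0∞) : Prop :=
  (∀ k, Measurable (g k)) ∧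
    ∃ N : Set X, μ N = 0 ∧ ∀ (k : ℤ) (x y : X), x ∉ N → y ∉ N →
      (2 : ℝ) ^ (-k - 1) ≤ dist x y → dist x y < (2 : ℝ) ^ (-k) →
      (u x - u y).abs ≤
        ENNReal.ofReal (dist x y ^ s x) * g k x + ENNReal.ofReal (dist x y ^ s y) * g k y

/-- The quasi-semi-norm of the homogeneous Hajłasz–Besov space: the infimum of the
`ℓ^{q(·)}(L^{p(·)})` quasi-norms of the vector `s(·)`-gradients of `u`. -/
def homBesovNorm (μ : Measure X) (s p : X → ℝ) (q : X → ℝ≥0∞) (u : X → EReal) : ℝ≥0∞ :=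
  ⨅ (g : ℤ → X → ℝ≥0∞) (_ : IsVectorGradient μ s u g) (_ : MemMixed μ p q g),
    mixedNorm μ p q g

/-- Membership in the homogeneous Hajłasz–Besov space. -/
def MemHomBesov (μ : Measure X) (s p : X → ℝ) (q : X → ℝ≥0∞) (u : X → EReal) : Prop :=
  MeasFiniteAE μ u ∧ homBesovNorm μ s p q u < ∞

/-- Membership in the inhomogeneous Hajłasz–Besov space, the intersection of the homogeneous one
with `L^{p(·)}`. -/
def MemBesov (μ : Measure X) (s p : X → ℝ) (q : X → ℝ≥0∞) (u : X → EReal) : Prop :=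
  MemHomBesov μ s p q u ∧ MemVarLp μ p (fun x => (u x).abs)

/-- The mean value `u_X` of `u` over `X`. -/
def mean (μ : Measure X) (u : X → EReal) : ℝ :=
  ⨍ x, (u x).toReal ∂μ

/-- The standing assumptions: `(X, d, μ)` is a bounded metric measure space of diameter `D`, all
of whose balls of positive radius have positive finite measure; `μ(B(x, r)) ≥ b r^{Q(x)}` for all
`r ∈ (0, δ]`; the exponents `Q, p, s, ε` are bounded log-Hölder exponents (with common bounds
`a, A` and common log-Hölder constant `L`), and `ess inf (s - ε) ≥ κ`. -/
structure Setting [BorelSpace X] (μ : Measure X) (b δ D a A L κ : ℝ) (Q p s ε : X → ℝ) :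
    Prop where
  bounded : Bornology.IsBounded (univ : Set X)
  diam_eq : Metric.diam (univ : Set X) = D
  ball_pos : ∀ (x : X) (r : ℝ), 0 < r → 0 < μ (Metric.ball x r)
  ball_lt_top : ∀ (x : X) (r : ℝ), 0 < r → μ (Metric.ball x r) < ∞
  lower_regular : ∀ (x : X) (r : ℝ), 0 < r → r ≤ δ →
    ENNReal.ofReal (b * r ^ Q x) ≤ μ (Metric.ball x r)
  exponent_Q : IsLogExponent μ a A L Q
  exponent_p : IsLogExponent μ a A L p
  exponent_s : IsLogExponent μ a A L s
  exponent_ε : IsLogExponent μ a A L ε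
  gap : ∀ᵐ x ∂μ, κ ≤ s x - ε x

end Besov

end VarBesov

end

open VarBesov

/-!
A function with an integrable scalar gradient `H` satisfies
`|v x - v y| ≤ d(x, y)^ε(x) H(x) + d(x, y)^ε(y) H(y)`. By Chebyshev's inequality and the lower
regularity of `μ`, every ball `B(x, r)` contains a point `z` with `H(z) ≲ r^(-Q(x)/p(x))`; the
log-Hölder condition allows the exponents to be frozen at `x`. Telescoping along such points of
`B(x, r 2^(-j))` gives, for every `J`,
`|v x - v y| ≲ ∑_{j ≤ J} (r 2^(-j))^(ε - Q/p)(x) + (r 2^(-J))^ε(x) H(x)`. If `ε p < Q` or `ε p = Q`,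
choosing `J` to balance the two terms bounds the oscillation by a power `H(x)^(1 - ε p/Q)` or by
`1 + log H(x)`, and the Sobolev and exponential estimates follow by integration; if `ε p > Q`, the
sum converges, which gives the Hölder estimate.

A vector gradient `(g_k)` of smoothness `s` is reduced to a scalar gradient of smoothness `ε` by
weighting `g_k` with a power of `2^(-k)` and taking the supremum over `k`. The gap `s - ε` makes the
weights summable, so that only `ρ_p(g_k / λ) ≤ 1` for each `k` is needed, and `q` plays no role.
-/

noncomputable section

namespace VarBesov

section LogModulus

/-- Logarithmic modulus of continuity: `f` oscillates by at most `M / log (1 / r)` on balls of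
radius `r < 1`. The product form avoids dividing by `log 1 = 0`. -/
def HasLogModulus {X : Type*} [PseudoMetricSpace X] (M : ℝ) (f : X → ℝ) : Prop :=
  ∀ x y r, 0 < r → r ≤ 1 → dist x y ≤ r → |f x - f y| * -Real.log r ≤ M

theorem LogHolderWith.hasLogModulus {X : Type*} [MetricSpace X] {L : ℝ} {f : X → ℝ}
    (h : LogHolderWith L f) : HasLogModulus (max L 0) f := by
  intro x y r hr _ hd
  rcases eq_or_ne x y with rfl | hxy
  · simp
  have hd0 : 0 < dist x y := dist_pos.2 hxy
  have log_le : -Real.log r ≤ Real.log (Real.exp 1 + 1 / dist x y) := by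
    rw [← Real.log_inv]
    apply Real.log_le_log (by positivity)
    have : r⁻¹ ≤ 1 / dist x y := by
      rw [one_div]
      exact inv_anti₀ hd0 hd
    linarith [Real.exp_pos 1]
  have log_pos : 0 < Real.log (Real.exp 1 + 1 / dist x y) := by
    apply Real.log_pos
    have : 0 < 1 / dist x y := by positivity
    linarith [Real.add_one_le_exp (1 : ℝ)]
  calc |f x - f y| * -Real.log r
      ≤ |f x - f y| * Real.log (Real.exp 1 + 1 / dist x y) := by gcongr
    _ ≤ L := (le_div_iff₀ log_pos).1 (h x y)
    _ ≤ max L 0 := le_max_left _ _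

namespace HasLogModulus

variable {X : Type*} [PseudoMetricSpace X] {M N A B : ℝ} {f g : X → ℝ}

theorem mono (hf : HasLogModulus M f) (h : M ≤ N) : HasLogModulus N f :=
  fun x y r hr hr1 hd => (hf x y r hr hr1 hd).trans h

theorem continuous (hf : HasLogModulus M f) : Continuous f := by
  rw [Metric.continuous_iff]
  intro y η hη
  have hM : 0 ≤ M := by simpa using hf y y 1 one_pos le_rfl (by simp)
  have hr1 : Real.exp (-((M + 1) / η)) ≤ 1 := Real.exp_le_one_iff.2 (neg_nonpos.2 (by positivity))
  refine ⟨_, Real.exp_pos (-((M + 1) / η)), fun x hx => ?_⟩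
  have osc_le := hf x y _ (Real.exp_pos _) hr1 hx.le
  rw [Real.log_exp, neg_neg, ← mul_div_assoc, div_le_iff₀ hη] at osc_le
  rw [Real.dist_eq]
  nlinarith

theorem sub (hf : HasLogModulus M f) (hg : HasLogModulus N g) :
    HasLogModulus (M + N) (fun x => f x - g x) := by
  intro x y r hr hr1 hd
  have hl : 0 ≤ -Real.log r := neg_nonneg.2 (Real.log_nonpos hr.le hr1)
  calc |f x - g x - (f y - g y)| * -Real.log r
      = |(f x - f y) - (g x - g y)| * -Real.log r := by rw [sub_sub_sub_comm]
    _ ≤ (|f x - f y| + |g x - g y|) * -Real.log r := by gcongr; exact abs_sub _ _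
    _ ≤ M + N := by
      rw [add_mul]
      exact add_le_add (hf x y r hr hr1 hd) (hg x y r hr hr1 hd)

theorem mul (hf : HasLogModulus M f) (hg : HasLogModulus N g) (hfA : ∀ x, |f x| ≤ A)
    (hgB : ∀ x, |g x| ≤ B) : HasLogModulus (A * N + B * M) (fun x => f x * g x) := by
  intro x y r hr hr1 hd
  have hl : 0 ≤ -Real.log r := neg_nonneg.2 (Real.log_nonpos hr.le hr1)
  calc |f x * g x - f y * g y| * -Real.log r
      = |f x * (g x - g y) + g y * (f x - f y)| * -Real.log r := by ring_nf
    _ ≤ (|f x| * |g x - g y| + |g y| * |f x - f y|) * -Real.log r := by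
      gcongr
      simpa only [abs_mul] using abs_add_le (f x * (g x - g y)) (g y * (f x - f y))
    _ = |f x| * (|g x - g y| * -Real.log r) + |g y| * (|f x - f y| * -Real.log r) := by ring
    _ ≤ A * N + B * M := by
      have hA : 0 ≤ A := (abs_nonneg _).trans (hfA x)
      have hB : 0 ≤ B := (abs_nonneg _).trans (hgB y)
      gcongr
      exacts [hfA x, hg x y r hr hr1 hd, hgB y, hf x y r hr hr1 hd]

theorem of_one_div (hf : HasLogModulus M (fun x => 1 / f x)) (hpos : ∀ x, 0 < f x)
    (hA : ∀ x, f x ≤ A) : HasLogModulus (A * A * M) f := by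
  intro x y r hr hr1 hd
  have hx := hpos x
  have hy := hpos y
  have hA0 : 0 ≤ A := hx.le.trans (hA x)
  have hl : 0 ≤ -Real.log r := neg_nonneg.2 (Real.log_nonpos hr.le hr1)
  have sub_eq : |f x - f y| = f x * f y * |1 / f x - 1 / f y| := by
    rw [div_sub_div _ _ hx.ne' hy.ne', abs_div, abs_of_pos (mul_pos hx hy), abs_sub_comm]
    field_simp
  rw [sub_eq, mul_assoc]
  gcongr
  exacts [hA x, hA y, hf x y r hr hr1 hd]

theorem rpow_le (hf : HasLogModulus M f) {x y : X} {r : ℝ} (hr : 0 < r) (hr1 : r ≤ 1)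
    (hd : dist x y ≤ r) : r ^ f x ≤ Real.exp M * r ^ f y := by
  rw [Real.rpow_def_of_pos hr, Real.rpow_def_of_pos hr, ← Real.exp_add, Real.exp_le_exp]
  have hl : 0 ≤ -Real.log r := neg_nonneg.2 (Real.log_nonpos hr.le hr1)
  have : (f y - f x) * -Real.log r ≤ |f x - f y| * -Real.log r := by
    gcongr
    rw [abs_sub_comm]
    exact le_abs_self _
  linarith [hf x y r hr hr1 hd]

end HasLogModulus

end LogModulus

section DyadicSum

/-- The sum of the geometric series of ratio `2 ^ (-c)`. -/
def geomConst (c : ℝ) : ℝ := (1 - (1 / 2) ^ c)⁻¹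

variable {c β r : ℝ}

theorem half_rpow_lt_one (hc : 0 < c) : (1 / 2 : ℝ) ^ c < 1 :=
  Real.rpow_lt_one (by norm_num) (by norm_num) hc

theorem one_le_geomConst (hc : 0 < c) : 1 ≤ geomConst c :=
  (one_le_inv₀ (sub_pos.2 (half_rpow_lt_one hc))).2 (sub_le_self _ (by positivity))

theorem sum_dyadic_rpow_le_last (hc : 0 < c) (hβ : β ≤ -c) (hr : 0 < r) (J : ℕ) :
    ∑ j ∈ Finset.range (J + 1), (r * (1 / 2) ^ j) ^ β ≤ geomConst c * (r * (1 / 2) ^ J) ^ β := by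
  have hG := one_le_geomConst hc
  have geom_fixed : geomConst c * (1 / 2) ^ c + 1 = geomConst c := by
    have := inv_mul_cancel₀ (sub_pos.2 (half_rpow_lt_one hc)).ne'
    unfold geomConst
    linarith
  induction J with
  | zero => simpa using le_mul_of_one_le_left (by positivity) hG
  | succ n ih =>
    set t := r * (1 / 2 : ℝ) ^ n
    have ht : 0 < t := by positivity
    have term_le : t ^ β ≤ (1 / 2) ^ c * (t * (1 / 2)) ^ β := by
      rw [Real.mul_rpow ht.le (by norm_num), mul_left_comm, ← Real.rpow_add (by norm_num)]
      refine le_mul_of_one_le_right (by positivity) ?_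
      exact Real.one_le_rpow_of_pos_of_le_one_of_nonpos (by norm_num) (by norm_num) (by linarith)
    rw [Finset.sum_range_succ, pow_succ, ← mul_assoc]
    calc _ ≤ geomConst c * ((1 / 2) ^ c * (t * (1 / 2)) ^ β) + (t * (1 / 2)) ^ β := by
          gcongr
          exact ih.trans (by gcongr)
      _ = (geomConst c * (1 / 2) ^ c + 1) * (t * (1 / 2)) ^ β := by ring
      _ = geomConst c * (t * (1 / 2)) ^ β := by rw [geom_fixed]

theorem sum_dyadic_rpow_le_first (hc : 0 < c) (hβ : c ≤ β) (hr : 0 ≤ r) (J : ℕ) :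
    ∑ j ∈ Finset.range J, (r * (1 / 2) ^ j) ^ β ≤ geomConst c * r ^ β := by
  have term_eq : ∀ j : ℕ, (r * (1 / 2) ^ j) ^ β = r ^ β * ((1 / 2) ^ β) ^ j := fun j => by
    rw [Real.mul_rpow hr (by positivity), ← Real.rpow_natCast, ← Real.rpow_natCast,
      ← Real.rpow_mul (by norm_num), ← Real.rpow_mul (by norm_num), mul_comm (j : ℝ)]
  have ratio_le : (1 / 2 : ℝ) ^ β ≤ (1 / 2) ^ c :=
    Real.rpow_le_rpow_of_exponent_ge (by norm_num) (by norm_num) hβ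
  have hlt := half_rpow_lt_one hc
  calc ∑ j ∈ Finset.range J, (r * (1 / 2) ^ j) ^ β
      ≤ ∑ j ∈ Finset.range J, r ^ β * ((1 / 2) ^ c) ^ j := by
        gcongr with j
        rw [term_eq]
        gcongr
    _ = r ^ β * ∑ j ∈ Finset.range J, ((1 / 2 : ℝ) ^ c) ^ j := by rw [Finset.mul_sum]
    _ ≤ r ^ β * geomConst c := by
      gcongr
      rw [geomConst, ← tsum_geometric_of_lt_one (by positivity) hlt]
      exact (summable_geometric_of_lt_one (by positivity) hlt).sum_le_tsum _
        fun i _ => by positivity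
    _ = geomConst c * r ^ β := mul_comm _ _

theorem exists_nat_rpow_mul_le_one {a e t : ℝ} (hr : 0 < r) (hr1 : r ≤ 1) (ha : 0 < a)
    (hae : a ≤ e) (ht : 1 ≤ t) :
    ∃ J : ℕ, (r * (1 / 2) ^ J) ^ e * t ≤ 1 ∧ (J : ℝ) ≤ Real.log t / (a * Real.log 2) + 1 := by
  have : 0 < Real.log 2 := Real.log_pos (by norm_num)
  have log_nonneg : 0 ≤ Real.log t := Real.log_nonneg ht
  set J := ⌈Real.log t / (a * Real.log 2)⌉₊
  have log_le : Real.log t ≤ J * (a * Real.log 2) :=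
    (div_le_iff₀ (by positivity)).1 (Nat.le_ceil _)
  refine ⟨J, ?_, (Nat.ceil_lt_add_one (by positivity)).le⟩
  calc (r * (1 / 2) ^ J) ^ e * t ≤ ((1 / 2) ^ J) ^ e * t := by
        have := ha.trans_le hae
        gcongr
        exact mul_le_of_le_one_left (by positivity) hr1
    _ ≤ ((1 / 2) ^ J) ^ a * t := by
        gcongr ?_ * _
        exact Real.rpow_le_rpow_of_exponent_ge (by positivity)
          (pow_le_one₀ (by norm_num) (by norm_num)) hae
    _ ≤ 1 := by
        rw [← Real.log_nonpos_iff (by positivity), Real.log_mul (by positivity) (by positivity),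
          Real.log_rpow (by positivity), Real.log_pow, one_div, Real.log_inv]
        linarith

end DyadicSum

/-- The constants quantifying the geometry of the space and the regularity of the exponents:
balls of radius `r ≤ R` have measure at least `b r ^ Q`, the diameter is at most `D`, the exponents
take values in `[a, A]`, and `M` is a common logarithmic modulus. Every constant below is a function
of these, of a bound `K` on a modular and of the gap `κ` between two exponents. -/
structure RegularityConstants where
  b : ℝ
  R : ℝ
  D : ℝ
  a : ℝ
  A : ℝ
  M : ℝ
  b_pos : 0 < b
  R_pos : 0 < R
  R_le_one : R ≤ 1
  one_le_D : 1 ≤ D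
  a_pos : 0 < a
  one_le_A : 1 ≤ A
  M_nonneg : 0 ≤ M

/-- A space of diameter at most `c.D` whose measure is lower `Q(·)`-regular up to scale `c.R`, with
exponents `Q`, `p`, `ε` that are bounded and log-regular at every point, with the constants `c`. -/
structure IsRegular {X : Type*} [PseudoMetricSpace X] [MeasurableSpace X]
    (c : RegularityConstants) (μ : Measure X) (Q p ε : X → ℝ) : Prop where
  dist_le : ∀ x y : X, dist x y ≤ c.D
  measure_univ_lt_top : μ univ < ∞
  lower_regular : ∀ (x : X) (r : ℝ), 0 < r → r ≤ c.R →
    ENNReal.ofReal (c.b * r ^ Q x) ≤ μ (Metric.ball x r)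
  measurable_p : Measurable p
  Q_mem : ∀ x, Q x ∈ Icc c.a c.A
  p_mem : ∀ x, p x ∈ Icc c.a c.A
  ε_mem : ∀ x, ε x ∈ Icc c.a c.A
  Q_log : HasLogModulus c.M Q
  one_div_p_log : HasLogModulus c.M (fun x => 1 / p x)
  ε_log : HasLogModulus c.M ε

/-- `H` is a Hajłasz gradient of variable smoothness `ε` of the function `v`, valid for pairs of
points of the set `S` of full measure, with `p(·)`-modular at most `K`. -/
structure HajlaszPair {X : Type*} [PseudoMetricSpace X] [MeasurableSpace X] (μ : Measure X)
    (p ε : X → ℝ) (K : ℝ≥0) (S : Set X) (v : X → ℝ) (H : X → ℝ≥0) : Prop where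
  measurable : Measurable H
  ae_mem : ∀ᵐ x ∂μ, x ∈ S
  pointwise_le : ∀ x ∈ S, ∀ y ∈ S, |v x - v y| ≤ dist x y ^ ε x * H x + dist x y ^ ε y * H y
  modular_le : modular μ p (fun x => (H x : ℝ≥0∞)) ≤ K

namespace RegularityConstants

variable (c : RegularityConstants) (K : ℝ≥0)

theorem A_pos : 0 < c.A := one_pos.trans_le c.one_le_A

theorem D_pos : 0 < c.D := one_pos.trans_le c.one_le_D

theorem one_le_R_rpow_neg {t : ℝ} (ht : 0 ≤ t) : 1 ≤ c.R ^ (-t) :=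
  Real.one_le_rpow_of_pos_of_le_one_of_nonpos c.R_pos c.R_le_one (neg_nonpos.2 ht)

/-- The constant of the good point lemma `IsRegular.exists_good_point`. -/
def goodPointConst : ℝ := (K / c.b + 1) ^ (1 / c.a) * Real.exp (c.A * c.M)

theorem goodPointConst_nonneg : 0 ≤ c.goodPointConst K := by
  have := c.b_pos
  unfold goodPointConst
  positivity

/-- The constant comparing `d(y, z) ^ ε(y)` with `r ^ ε(x)` for points within `O(r)`. -/
def scaleConst : ℝ := 3 ^ c.A * Real.exp c.M

theorem scaleConst_nonneg : 0 ≤ c.scaleConst := by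
  unfold scaleConst
  positivity

theorem one_le_scaleConst : 1 ≤ c.scaleConst :=
  one_le_mul_of_one_le_of_one_le (Real.one_le_rpow (by norm_num) c.A_pos.le)
    (Real.one_le_exp c.M_nonneg)

/-- The constant of the telescoping estimate along a chain of good points. -/
def chainConst : ℝ :=
  c.scaleConst * (1 + c.goodPointConst K * (1 + 2 ^ (c.A / c.a)))

theorem one_le_chainConst : 1 ≤ c.chainConst K := by
  have := c.goodPointConst_nonneg K
  exact one_le_mul_of_one_le_of_one_le c.one_le_scaleConst (le_add_of_nonneg_right (by positivity))

theorem chainConst_nonneg : 0 ≤ c.chainConst K := zero_le_one.trans (c.one_le_chainConst K)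

end RegularityConstants

section Regular

variable {X : Type*} [PseudoMetricSpace X] [MeasurableSpace X] {c : RegularityConstants}
  {μ : Measure X} {Q p ε : X → ℝ} {K : ℝ≥0} {S : Set X} {v : X → ℝ} {H : X → ℝ≥0}

namespace IsRegular

theorem isFiniteMeasure (h : IsRegular c μ Q p ε) : IsFiniteMeasure μ := ⟨h.measure_univ_lt_top⟩

theorem Q_pos (h : IsRegular c μ Q p ε) (x : X) : 0 < Q x := c.a_pos.trans_le (h.Q_mem x).1

theorem p_pos (h : IsRegular c μ Q p ε) (x : X) : 0 < p x := c.a_pos.trans_le (h.p_mem x).1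

theorem ε_pos (h : IsRegular c μ Q p ε) (x : X) : 0 < ε x := c.a_pos.trans_le (h.ε_mem x).1

theorem div_le (h : IsRegular c μ Q p ε) (x : X) : Q x / p x ≤ c.A / c.a := by
  have := c.a_pos
  have := c.A_pos
  gcongr
  exacts [(h.Q_mem x).2, (h.p_mem x).1]

theorem rpow_neg_div_le (h : IsRegular c μ Q p ε) (x : X) :
    c.R ^ (-(Q x / p x)) ≤ c.R ^ (-(c.A / c.a)) :=
  Real.rpow_le_rpow_of_exponent_ge c.R_pos c.R_le_one (neg_le_neg (h.div_le x))

theorem half_rpow_neg_div_le (h : IsRegular c μ Q p ε) {r : ℝ} (hr : 0 < r) (x : X) :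
    (r * (1 / 2)) ^ (-(Q x / p x)) ≤ 2 ^ (c.A / c.a) * r ^ (-(Q x / p x)) := by
  rw [Real.mul_rpow hr.le (by norm_num), one_div, Real.inv_rpow (by norm_num),
    ← Real.rpow_neg (by norm_num), neg_neg, mul_comm]
  exact mul_le_mul_of_nonneg_right
    (Real.rpow_le_rpow_of_exponent_le (by norm_num) (h.div_le x)) (by positivity)

theorem rpow_neg_div_le_of_dist_le (h : IsRegular c μ Q p ε) {x y : X} {r : ℝ} (hr : 0 < r)
    (hr1 : r ≤ 1) (hd : dist x y ≤ r) :
    r ^ (-(Q x / p y)) ≤ Real.exp (c.A * c.M) * r ^ (-(Q x / p x)) := by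
  have hQ := h.Q_pos x
  have rpow_le : r ^ (Q x / p x) ≤ Real.exp (c.A * c.M) * r ^ (Q x / p y) := by
    calc r ^ (Q x / p x) = (r ^ (1 / p x)) ^ Q x := by
          rw [← Real.rpow_mul hr.le, one_div_mul_eq_div]
      _ ≤ (Real.exp c.M * r ^ (1 / p y)) ^ Q x := by
          gcongr
          exact h.one_div_p_log.rpow_le hr hr1 hd
      _ = Real.exp (Q x * c.M) * r ^ (Q x / p y) := by
          rw [Real.mul_rpow (by positivity) (by positivity), ← Real.exp_mul, ← Real.rpow_mul hr.le,
            one_div_mul_eq_div, mul_comm c.M]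
      _ ≤ Real.exp (c.A * c.M) * r ^ (Q x / p y) := by
          have := c.M_nonneg
          gcongr
          exact (h.Q_mem x).2
  rw [Real.rpow_neg hr.le, Real.rpow_neg hr.le, ← div_eq_mul_inv, inv_eq_one_div,
    div_le_div_iff₀ (by positivity) (by positivity), one_mul]
  exact rpow_le

theorem exists_rpow_le_of_modular_le [OpensMeasurableSpace X] (h : IsRegular c μ Q p ε)
    {F : X → ℝ≥0} (hF : Measurable F) (hmod : modular μ p (fun x => (F x : ℝ≥0∞)) ≤ K)
    (hS : ∀ᵐ x ∂μ, x ∈ S) (x : X) {r : ℝ} (hr : 0 < r) (hrR : r ≤ c.R) :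
    ∃ y ∈ S, dist x y < r ∧ (F y : ℝ) ^ p y ≤ K / c.b * r ^ (-Q x) := by
  have hb := c.b_pos
  have := h.isFiniteMeasure
  have ball_pos : 0 < μ (Metric.ball x r) :=
    (ENNReal.ofReal_pos.2 (by positivity)).trans_le (h.lower_regular x r hr hrR)
  have hmeas : Measurable fun x => (F x : ℝ≥0∞) ^ p x := hF.coe_nnreal_ennreal.pow h.measurable_p
  obtain ⟨y, hy, hle⟩ := exists_notMem_null_le_laverage
    (μ := μ.restrict (Metric.ball x r)) (Measure.restrict_eq_zero.not.2 ball_pos.ne')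
    hmeas.aemeasurable
    (ae_iff.1 ((ae_restrict_of_ae hS).and (ae_restrict_mem measurableSet_ball)))
  obtain ⟨hyS, hyr⟩ := not_not.1 hy
  refine ⟨y, hyS, Metric.mem_ball'.1 hyr, ?_⟩
  have average_le : (F y : ℝ≥0∞) ^ p y ≤ K / ENNReal.ofReal (c.b * r ^ Q x) := by
    rw [setLAverage_eq] at hle
    exact hle.trans (ENNReal.div_le_div ((setLIntegral_le_lintegral _ _).trans hmod)
      (h.lower_regular x r hr hrR))
  have := ENNReal.toReal_mono (ENNReal.div_ne_top ENNReal.coe_ne_top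
    (ENNReal.ofReal_pos.2 (by positivity)).ne') average_le
  rwa [← ENNReal.toReal_rpow, ENNReal.toReal_div, ENNReal.toReal_ofReal (by positivity),
    ENNReal.coe_toReal, ENNReal.coe_toReal, ← div_div, div_eq_mul_inv _ (r ^ Q x),
    ← Real.rpow_neg hr.le] at this

theorem exists_good_point [OpensMeasurableSpace X] (h : IsRegular c μ Q p ε) {F : X → ℝ≥0}
    (hF : Measurable F) (hmod : modular μ p (fun x => (F x : ℝ≥0∞)) ≤ K)
    (hS : ∀ᵐ x ∂μ, x ∈ S) (x : X) {r : ℝ} (hr : 0 < r) (hrR : r ≤ c.R) :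
    ∃ y ∈ S, dist x y < r ∧ F y ≤ c.goodPointConst K * r ^ (-(Q x / p x)) := by
  obtain ⟨y, hyS, hxy, hFy⟩ := h.exists_rpow_le_of_modular_le hF hmod hS x hr hrR
  refine ⟨y, hyS, hxy, ?_⟩
  have hp := h.p_pos y
  have ha := c.a_pos
  have hKb : 0 ≤ K / c.b := div_nonneg K.2 c.b_pos.le
  calc (F y : ℝ) = ((F y : ℝ) ^ p y) ^ (1 / p y) := by
        rw [← Real.rpow_mul (F y).coe_nonneg, mul_one_div_cancel hp.ne', Real.rpow_one]
    _ ≤ ((K / c.b + 1) * r ^ (-Q x)) ^ (1 / p y) := by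
        gcongr
        exact hFy.trans (by gcongr; exact le_add_of_nonneg_right zero_le_one)
    _ = (K / c.b + 1) ^ (1 / p y) * r ^ (-(Q x / p y)) := by
        rw [Real.mul_rpow (by positivity) (by positivity), ← Real.rpow_mul hr.le,
          neg_mul, mul_one_div]
    _ ≤ (K / c.b + 1) ^ (1 / c.a) * (Real.exp (c.A * c.M) * r ^ (-(Q x / p x))) := by
        gcongr
        · exact le_add_of_nonneg_left hKb
        · exact (h.p_mem y).1
        · exact h.rpow_neg_div_le_of_dist_le hr (hrR.trans c.R_le_one) hxy.le
    _ = c.goodPointConst K * r ^ (-(Q x / p x)) := by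
        rw [RegularityConstants.goodPointConst, mul_assoc]

theorem dist_rpow_le (h : IsRegular c μ Q p ε) {x y z : X} {r : ℝ} (hr : 0 < r) (hr1 : r ≤ 1)
    (hxy : dist x y ≤ r) (hyz : dist y z ≤ 3 * r) :
    dist y z ^ ε y ≤ c.scaleConst * r ^ ε x := by
  have hε := h.ε_pos y
  calc dist y z ^ ε y ≤ (3 * r) ^ ε y := by gcongr
    _ = 3 ^ ε y * r ^ ε y := Real.mul_rpow (by norm_num) hr.le
    _ ≤ 3 ^ c.A * (Real.exp c.M * r ^ ε x) := by
        gcongr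
        · norm_num
        · exact (h.ε_mem y).2
        · exact h.ε_log.rpow_le hr hr1 (by rwa [dist_comm])
    _ = c.scaleConst * r ^ ε x := by rw [RegularityConstants.scaleConst, mul_assoc]

end IsRegular

namespace HajlaszPair

theorem abs_sub_le_near (hp : HajlaszPair μ p ε K S v H) (h : IsRegular c μ Q p ε)
    {x x' y y' : X} {r : ℝ} (hr : 0 < r) (hr1 : r ≤ 1) (hy : y ∈ S) (hy' : y' ∈ S)
    (hxy : dist x y ≤ r) (hxy' : dist x' y' ≤ r) (hyy' : dist y y' ≤ 3 * r) :
    |v y - v y'| ≤ c.scaleConst * (r ^ ε x * H y + r ^ ε x' * H y') := by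
  calc |v y - v y'| ≤ dist y y' ^ ε y * H y + dist y y' ^ ε y' * H y' := hp.pointwise_le y hy y' hy'
    _ ≤ c.scaleConst * r ^ ε x * H y + c.scaleConst * r ^ ε x' * H y' := by
        gcongr
        · exact h.dist_rpow_le hr hr1 hxy hyy'
        · rw [dist_comm] at hyy' ⊢
          exact h.dist_rpow_le hr hr1 hxy' hyy'
    _ = _ := by ring

theorem abs_sub_le_of_good (hp : HajlaszPair μ p ε K S v H) (h : IsRegular c μ Q p ε)
    {x y : X} {r T : ℝ} (hr : 0 < r) (hr1 : r ≤ 1) (hx : x ∈ S) (hy : y ∈ S) (hxy : dist x y ≤ r)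
    (hH : H y ≤ T * r ^ (-(Q x / p x))) :
    |v y - v x| ≤ c.scaleConst * (T * r ^ (ε x - Q x / p x) + r ^ ε x * H x) := by
  have hyx : dist y x ≤ 3 * r := by
    rw [dist_comm]
    linarith
  have hE := c.scaleConst_nonneg
  calc |v y - v x| ≤ c.scaleConst * (r ^ ε x * H y + r ^ ε x * H x) :=
        hp.abs_sub_le_near h hr hr1 hy hx hxy ((dist_self x).trans_le hr.le) hyx
    _ ≤ c.scaleConst * (r ^ ε x * (T * r ^ (-(Q x / p x))) + r ^ ε x * H x) := by gcongr
    _ = _ := by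
        rw [sub_eq_add_neg, Real.rpow_add hr]
        ring

theorem abs_sub_le_of_good_of_good_half (hp : HajlaszPair μ p ε K S v H)
    (h : IsRegular c μ Q p ε) {x y y' : X} {r T : ℝ} (hr : 0 < r) (hr1 : r ≤ 1) (hT : 0 ≤ T)
    (hy : y ∈ S) (hy' : y' ∈ S) (hxy : dist x y ≤ r) (hxy' : dist x y' ≤ r * (1 / 2))
    (hH : H y ≤ T * r ^ (-(Q x / p x))) (hH' : H y' ≤ T * (r * (1 / 2)) ^ (-(Q x / p x))) :
    |v y - v y'| ≤ c.scaleConst * (T * (1 + 2 ^ (c.A / c.a))) * r ^ (ε x - Q x / p x) := by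
  have hE := c.scaleConst_nonneg
  have hyy' : dist y y' ≤ 3 * r := by linarith [dist_triangle_left y y' x]
  calc |v y - v y'| ≤ c.scaleConst * (r ^ ε x * H y + r ^ ε x * H y') :=
        hp.abs_sub_le_near h hr hr1 hy hy' hxy (hxy'.trans (by linarith)) hyy'
    _ ≤ c.scaleConst * (r ^ ε x * (T * r ^ (-(Q x / p x))) +
          r ^ ε x * (T * (2 ^ (c.A / c.a) * r ^ (-(Q x / p x))))) := by
        gcongr
        exact hH'.trans (mul_le_mul_of_nonneg_left (h.half_rpow_neg_div_le hr x) hT)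
    _ = _ := by
        rw [sub_eq_add_neg, Real.rpow_add hr]
        ring

theorem exists_chain [OpensMeasurableSpace X] (hp : HajlaszPair μ p ε K S v H)
    (h : IsRegular c μ Q p ε) {x : X} (hx : x ∈ S) {r : ℝ} (hr : 0 < r) (hrR : r ≤ c.R) :
    ∃ y ∈ S, dist x y < r ∧ H y ≤ c.goodPointConst K * r ^ (-(Q x / p x)) ∧ ∀ J : ℕ,
      |v x - v y| ≤ c.chainConst K *
        (∑ j ∈ Finset.range (J + 1), (r * (1 / 2) ^ j) ^ (ε x - Q x / p x) +
          (r * (1 / 2) ^ J) ^ ε x * H x) := by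
  set ρ : ℕ → ℝ := fun j => r * (1 / 2) ^ j with hρ
  have ρ_pos : ∀ j, 0 < ρ j := fun j => by positivity
  have ρ_le : ∀ j, ρ j ≤ c.R := fun j =>
    (mul_le_of_le_one_right hr.le (pow_le_one₀ (by norm_num) (by norm_num))).trans hrR
  have ρ_le_one : ∀ j, ρ j ≤ 1 := fun j => (ρ_le j).trans c.R_le_one
  have ρ_succ : ∀ j, ρ (j + 1) = ρ j * (1 / 2) := fun j => by
    rw [hρ]
    ring
  have hT := c.goodPointConst_nonneg K
  have hE := c.scaleConst_nonneg
  choose y hyS hxy hHy using fun j =>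
    h.exists_good_point hp.measurable hp.modular_le hp.ae_mem x (ρ_pos j) (ρ_le j)
  refine ⟨y 0, hyS 0, by simpa [hρ] using hxy 0, by simpa [hρ] using hHy 0, fun J => ?_⟩
  have step : ∀ j, |v (y j) - v (y (j + 1))| ≤
      c.scaleConst * (c.goodPointConst K * (1 + 2 ^ (c.A / c.a))) * ρ j ^ (ε x - Q x / p x) :=
    fun j => hp.abs_sub_le_of_good_of_good_half h (ρ_pos j) (ρ_le_one j) hT (hyS j) (hyS (j + 1))
      (hxy j).le (ρ_succ j ▸ (hxy (j + 1)).le) (hHy j) (ρ_succ j ▸ hHy (j + 1))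
  have telescope := dist_le_range_sum_of_dist_le J fun {j} (_ : j < J) =>
    (Real.dist_eq (v (y j)) _).trans_le (step j)
  rw [Real.dist_eq, ← Finset.mul_sum] at telescope
  have last_step := hp.abs_sub_le_of_good h (ρ_pos J) (ρ_le_one J) hx (hyS J) (hxy J).le (hHy J)
  have triangle : |v x - v (y 0)| ≤ |v (y 0) - v (y J)| + |v (y J) - v x| := by
    rw [abs_sub_comm]
    exact abs_sub_le _ _ _
  refine triangle.trans ((add_le_add telescope last_step).trans ?_)
  rw [Finset.sum_range_succ, RegularityConstants.chainConst]
  change _ ≤ c.scaleConst * _ * (∑ j ∈ Finset.range J, ρ j ^ (ε x - Q x / p x) +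
    ρ J ^ (ε x - Q x / p x) + ρ J ^ ε x * H x)
  set N := ∑ j ∈ Finset.range J, ρ j ^ (ε x - Q x / p x)
  have hN : 0 ≤ N := Finset.sum_nonneg fun j _ => by positivity
  have slack : 0 ≤ c.scaleConst * (N +
      (1 + c.goodPointConst K * 2 ^ (c.A / c.a)) * ρ J ^ (ε x - Q x / p x) +
      c.goodPointConst K * (1 + 2 ^ (c.A / c.a)) * (ρ J ^ ε x * H x)) := by positivity
  linarith

end HajlaszPair

end Regular

theorem exists_dyadic_scale {t e d : ℝ} (ht : 1 ≤ t) (he : 0 ≤ e) (hd : 0 < d) (hed : e ≤ d) :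
    ∃ J : ℕ, ((1 / 2 : ℝ) ^ J) ^ (e - d) ≤ t ^ (1 - e / d) ∧
      ((1 / 2 : ℝ) ^ J) ^ e * t ≤ 2 ^ e * t ^ (1 - e / d) := by
  have ht0 : 0 < t := one_pos.trans_le ht
  set τ : ℝ := t ^ (-(1 / d)) with hτ
  have τ_pos : 0 < τ := by positivity
  have τ_le_one : τ ≤ 1 := Real.rpow_le_one_of_one_le_of_nonpos ht (neg_nonpos.2 (by positivity))
  have τ_rpow : ∀ β, τ ^ β = t ^ (-(β / d)) := fun β => by
    rw [hτ, ← Real.rpow_mul ht0.le]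
    ring_nf
  obtain ⟨J, hJ_lt, hJ_le⟩ := exists_nat_pow_near_of_lt_one τ_pos τ_le_one
    (by norm_num : (0 : ℝ) < 1 / 2) (by norm_num)
  refine ⟨J, ?_, ?_⟩
  · calc ((1 / 2 : ℝ) ^ J) ^ (e - d) ≤ τ ^ (e - d) :=
          Real.rpow_le_rpow_of_nonpos τ_pos hJ_le (sub_nonpos.2 hed)
      _ = t ^ (1 - e / d) := by
          rw [τ_rpow, sub_div, div_self hd.ne', neg_sub]
  · have hJ : (1 / 2 : ℝ) ^ J ≤ 2 * τ := by
      rw [pow_succ] at hJ_lt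
      linarith
    calc ((1 / 2 : ℝ) ^ J) ^ e * t ≤ (2 * τ) ^ e * t := by gcongr
      _ = 2 ^ e * (t ^ (1 : ℝ) * t ^ (-(e / d))) := by
          rw [Real.mul_rpow (by norm_num) τ_pos.le, τ_rpow, Real.rpow_one]
          ring
      _ = 2 ^ e * t ^ (1 - e / d) := by rw [← Real.rpow_add ht0, ← sub_eq_add_neg]

namespace RegularityConstants

variable (c : RegularityConstants) (K : ℝ≥0) (T κ : ℝ)

/-- The bound at a good point of scale `c.R`. -/
def baseConst : ℝ := c.goodPointConst K * c.R ^ (-(c.A / c.a))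

theorem baseConst_nonneg : 0 ≤ c.baseConst K :=
  mul_nonneg (c.goodPointConst_nonneg K) (Real.rpow_nonneg c.R_pos.le _)

/-- The constant of the oscillation estimate relative to a point where the gradient is at most
`T`. -/
def oscConst : ℝ := c.chainConst K + 2 * c.D ^ c.A * (T + c.baseConst K)

variable {T} in
theorem one_le_oscConst (hT : 0 ≤ T) : 1 ≤ c.oscConst K T := by
  have := c.D_pos
  have := c.baseConst_nonneg K
  exact (c.one_le_chainConst K).trans (le_add_of_nonneg_right (by positivity))

/-- The constant of the pointwise estimate in the case `Q - ε p ≥ κ > 0`. -/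
def subcriticalConst : ℝ :=
  c.oscConst K T * (1 + geomConst (κ / c.A) * c.R ^ (-(c.A / c.a)) + 2 ^ c.A)

variable {T κ} in
theorem one_le_subcriticalConst (hT : 0 ≤ T) (hκ : 0 < κ) : 1 ≤ c.subcriticalConst K T κ := by
  have hR := c.R_pos
  have hG := one_le_geomConst (div_pos hκ c.A_pos)
  refine one_le_mul_of_one_le_of_one_le (c.one_le_oscConst K hT) ?_
  rw [add_assoc]
  exact le_add_of_nonneg_right (by positivity)

/-- The constant of the pointwise estimate in the case `ε p = Q`. -/
def criticalConst : ℝ := c.oscConst K T * (4 + 1 / (c.a * Real.log 2))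

variable {T} in
theorem one_le_criticalConst (hT : 0 ≤ T) : 1 ≤ c.criticalConst K T := by
  have ha := c.a_pos
  have : 0 < Real.log 2 := Real.log_pos (by norm_num)
  have : 0 ≤ 1 / (c.a * Real.log 2) := by positivity
  exact one_le_mul_of_one_le_of_one_le (c.one_le_oscConst K hT) (by linarith)

end RegularityConstants

section PointwiseEstimates

variable {X : Type*} [PseudoMetricSpace X] [MeasurableSpace X] {c : RegularityConstants}
  {μ : Measure X} {Q p ε : X → ℝ} {K : ℝ≥0} {S : Set X} {v : X → ℝ} {H : X → ℝ≥0} {T κ : ℝ}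

theorem IsRegular.exists_le_baseConst [OpensMeasurableSpace X] [Nonempty X]
    (h : IsRegular c μ Q p ε) {F : X → ℝ≥0} (hF : Measurable F)
    (hmod : modular μ p (fun x => (F x : ℝ≥0∞)) ≤ K) (hS : ∀ᵐ x ∂μ, x ∈ S) :
    ∃ y ∈ S, F y ≤ c.baseConst K := by
  obtain ⟨x⟩ := ‹Nonempty X›
  obtain ⟨y, hy, -, hFy⟩ := h.exists_good_point hF hmod hS x c.R_pos le_rfl
  refine ⟨y, hy, hFy.trans ?_⟩
  exact mul_le_mul_of_nonneg_left (h.rpow_neg_div_le x) (c.goodPointConst_nonneg K)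

theorem IsRegular.sub_div_le (h : IsRegular c μ Q p ε) (hκ : 0 ≤ κ) {x : X}
    (hgap : κ ≤ Q x - ε x * p x) : ε x - Q x / p x ≤ -(κ / c.A) := by
  have hpx := h.p_pos x
  have : κ / c.A ≤ (Q x - ε x * p x) / p x :=
    div_le_div₀ (hκ.trans hgap) hgap hpx (h.p_mem x).2
  rw [sub_div, mul_div_cancel_right₀ _ hpx.ne'] at this
  linarith

theorem IsRegular.le_sub_div (h : IsRegular c μ Q p ε) (hκ : 0 ≤ κ) {x : X}
    (hgap : κ ≤ ε x * p x - Q x) : κ / c.A ≤ ε x - Q x / p x := by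
  have hpx := h.p_pos x
  have : κ / c.A ≤ (ε x * p x - Q x) / p x :=
    div_le_div₀ (hκ.trans hgap) hgap hpx (h.p_mem x).2
  rwa [sub_div, mul_div_cancel_right₀ _ hpx.ne'] at this

namespace HajlaszPair

theorem abs_sub_le_of_le (hp : HajlaszPair μ p ε K S v H) (h : IsRegular c μ Q p ε) {y z : X}
    (hy : y ∈ S) (hz : z ∈ S) (hHy : H y ≤ T) (hHz : H z ≤ T) :
    |v y - v z| ≤ 2 * c.D ^ c.A * T := by
  have hD := c.D_pos
  have dist_rpow_le : ∀ w, dist y z ^ ε w ≤ c.D ^ c.A := fun w =>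
    (Real.rpow_le_rpow dist_nonneg (h.dist_le y z) (h.ε_pos w).le).trans
      (Real.rpow_le_rpow_of_exponent_le c.one_le_D (h.ε_mem w).2)
  calc |v y - v z| ≤ dist y z ^ ε y * H y + dist y z ^ ε z * H z := hp.pointwise_le y hy z hz
    _ ≤ c.D ^ c.A * T + c.D ^ c.A * T := by
        gcongr
        exacts [dist_rpow_le y, dist_rpow_le z]
    _ = 2 * c.D ^ c.A * T := by ring

theorem abs_sub_le_sum [OpensMeasurableSpace X] (hp : HajlaszPair μ p ε K S v H)
    (h : IsRegular c μ Q p ε) {x y : X} (hx : x ∈ S) (hy : y ∈ S) (hHy : H y ≤ T) (J : ℕ) :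
    |v x - v y| ≤ c.oscConst K T *
      (1 + ∑ j ∈ Finset.range (J + 1), (c.R * (1 / 2) ^ j) ^ (ε x - Q x / p x) +
        (c.R * (1 / 2) ^ J) ^ ε x * H x) := by
  obtain ⟨z, hz, -, hHz, hxz⟩ := hp.exists_chain h hx c.R_pos le_rfl
  have hT : 0 ≤ T := (H y).2.trans hHy
  have hR := c.R_pos
  have hD := c.D_pos
  have hB := c.baseConst_nonneg K
  have hC := c.chainConst_nonneg K
  have z_le : (H z : ℝ) ≤ T + c.baseConst K := (hHz.trans (mul_le_mul_of_nonneg_left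
    (h.rpow_neg_div_le x) (c.goodPointConst_nonneg K))).trans (le_add_of_nonneg_left hT)
  have hzy := hp.abs_sub_le_of_le h hz hy z_le (hHy.trans (le_add_of_nonneg_right hB))
  refine (abs_sub_le (v x) (v z) (v y)).trans ((add_le_add (hxz J) hzy).trans ?_)
  set N := ∑ j ∈ Finset.range (J + 1), (c.R * (1 / 2) ^ j) ^ (ε x - Q x / p x)
  have hN : 0 ≤ N := Finset.sum_nonneg fun j _ => by positivity
  have slack : 0 ≤ c.chainConst K + 2 * c.D ^ c.A * (T + c.baseConst K) *
      (N + (c.R * (1 / 2) ^ J) ^ ε x * H x) := by positivity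
  unfold RegularityConstants.oscConst
  linarith

theorem abs_sub_le_rpow [OpensMeasurableSpace X] (hp : HajlaszPair μ p ε K S v H)
    (h : IsRegular c μ Q p ε) (hκ : 0 < κ) {x y : X} (hgap : κ ≤ Q x - ε x * p x) (hx : x ∈ S)
    (hy : y ∈ S) (hHy : H y ≤ T) :
    |v x - v y| ≤ c.subcriticalConst K T κ * max 1 (H x : ℝ) ^ (1 - ε x * p x / Q x) := by
  have hR := c.R_pos
  have hε := h.ε_pos x
  have hQp : 0 < Q x / p x := div_pos (h.Q_pos x) (h.p_pos x)
  have hβ := h.sub_div_le hκ.le hgap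
  have hκA : 0 < κ / c.A := div_pos hκ c.A_pos
  have hG := one_le_geomConst hκA
  have hC := zero_le_one.trans (c.one_le_oscConst K ((H y).2.trans hHy))
  set t : ℝ := max 1 (H x)
  have one_le_t : 1 ≤ t := le_max_left _ _
  obtain ⟨J, hJβ, hJε⟩ := exists_dyadic_scale one_le_t hε.le hQp (by linarith)
  rw [div_div_eq_mul_div] at hJβ hJε
  set β := ε x - Q x / p x
  set θ := 1 - ε x * p x / Q x
  have one_le_rpow : 1 ≤ t ^ θ := by
    refine Real.one_le_rpow one_le_t (sub_nonneg.2 ((div_le_one (h.Q_pos x)).2 ?_))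
    linarith
  have last_scale_le : (c.R * (1 / 2) ^ J) ^ β ≤ c.R ^ (-(c.A / c.a)) * t ^ θ := by
    rw [Real.mul_rpow hR.le (by positivity)]
    gcongr ?_ * ?_
    exact Real.rpow_le_rpow_of_exponent_ge hR c.R_le_one (by linarith [h.div_le x])
  have remainder_le : (c.R * (1 / 2) ^ J) ^ ε x * H x ≤ 2 ^ c.A * t ^ θ := by
    calc (c.R * (1 / 2) ^ J) ^ ε x * H x ≤ ((1 / 2) ^ J) ^ ε x * t := by
          gcongr
          · exact mul_le_of_le_one_left (by positivity) c.R_le_one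
          · exact le_max_right _ _
      _ ≤ 2 ^ ε x * t ^ θ := hJε
      _ ≤ 2 ^ c.A * t ^ θ := by
          gcongr
          exacts [by norm_num, (h.ε_mem x).2]
  calc |v x - v y| ≤ _ := hp.abs_sub_le_sum h hx hy hHy J
    _ ≤ c.oscConst K T * (t ^ θ + geomConst (κ / c.A) * (c.R ^ (-(c.A / c.a)) * t ^ θ) +
          2 ^ c.A * t ^ θ) := by
        gcongr
        exact (sum_dyadic_rpow_le_last hκA hβ hR J).trans (by gcongr)
    _ = _ := by
        unfold RegularityConstants.subcriticalConst
        ring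

theorem abs_sub_le_log [OpensMeasurableSpace X] (hp : HajlaszPair μ p ε K S v H)
    (h : IsRegular c μ Q p ε) {x y : X} (hcrit : ε x * p x = Q x) (hx : x ∈ S) (hy : y ∈ S)
    (hHy : H y ≤ T) :
    |v x - v y| ≤ c.criticalConst K T * (1 + Real.log (max 1 (H x))) := by
  have ha := c.a_pos
  have hε := h.ε_mem x
  have : 0 < Real.log 2 := Real.log_pos (by norm_num)
  have hβ : ε x - Q x / p x = 0 := by
    rw [← hcrit, mul_div_cancel_right₀ _ (h.p_pos x).ne', sub_self]
  have hC := zero_le_one.trans (c.one_le_oscConst K ((H y).2.trans hHy))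
  set t : ℝ := max 1 (H x)
  have one_le_t : 1 ≤ t := le_max_left _ _
  have log_nonneg : 0 ≤ Real.log t := Real.log_nonneg one_le_t
  obtain ⟨J, remainder_le, J_le⟩ :=
    exists_nat_rpow_mul_le_one c.R_pos c.R_le_one ha hε.1 one_le_t
  replace remainder_le : (c.R * (1 / 2) ^ J) ^ ε x * H x ≤ 1 := by
    have := c.R_pos
    exact (mul_le_mul_of_nonneg_left (le_max_right _ _) (by positivity)).trans remainder_le
  have chain := hp.abs_sub_le_sum h hx hy hHy J
  simp only [hβ, Real.rpow_zero, Finset.sum_const, Finset.card_range, nsmul_eq_mul, mul_one,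
    Nat.cast_add_one] at chain
  calc |v x - v y| ≤ _ := chain
    _ ≤ c.oscConst K T * (1 + ((Real.log t / (c.a * Real.log 2) + 1) + 1) + 1) := by gcongr
    _ ≤ c.oscConst K T * ((4 + 1 / (c.a * Real.log 2)) * (1 + Real.log t)) := by
        gcongr
        have : 0 < 1 / (c.a * Real.log 2) := by positivity
        rw [div_eq_mul_one_div]
        nlinarith
    _ = _ := by
        unfold RegularityConstants.criticalConst
        ring

end HajlaszPair

end PointwiseEstimates

namespace RegularityConstants

variable (c : RegularityConstants) (K : ℝ≥0) (κ : ℝ)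

/-- The constant of the convergent telescoping sum in the case `ε p - Q ≥ κ > 0`. -/
def limitConst : ℝ := c.chainConst K * geomConst (κ / c.A)

/-- The bound on the oscillation in the case `ε p - Q ≥ κ > 0`. -/
def boundConst : ℝ := 2 * c.limitConst K κ + 2 * c.D ^ c.A * c.baseConst K

/-- The constant of the Hölder estimate at distances `d(x, y) ≤ R`. -/
def localHolderConst : ℝ :=
  (c.limitConst K κ + c.scaleConst * c.goodPointConst K) *
    (1 + Real.exp (c.M + (c.A * c.M + 1 / c.a * c.M)))

/-- The constant of the Hölder estimate at all distances. -/
def holderConst : ℝ := c.boundConst K κ * c.R ^ (-c.A) + c.localHolderConst K κ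

variable {κ}

theorem one_le_limitConst (hκ : 0 < κ) : 1 ≤ c.limitConst K κ :=
  one_le_mul_of_one_le_of_one_le (c.one_le_chainConst K)
    (one_le_geomConst (div_pos hκ c.A_pos))

theorem one_le_boundConst (hκ : 0 < κ) : 1 ≤ c.boundConst K κ := by
  have := c.D_pos
  have := c.baseConst_nonneg K
  have : 0 ≤ 2 * c.D ^ c.A * c.baseConst K := by positivity
  unfold boundConst
  linarith [c.one_le_limitConst K hκ]

theorem localHolderConst_nonneg (hκ : 0 < κ) : 0 ≤ c.localHolderConst K κ := by
  have := c.one_le_limitConst K hκ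
  have := c.scaleConst_nonneg
  have := c.goodPointConst_nonneg K
  unfold localHolderConst
  positivity

theorem one_le_holderConst (hκ : 0 < κ) : 1 ≤ c.holderConst K κ :=
  (one_le_mul_of_one_le_of_one_le (c.one_le_boundConst K hκ)
    (c.one_le_R_rpow_neg c.A_pos.le)).trans
    (le_add_of_nonneg_right (c.localHolderConst_nonneg K hκ))

end RegularityConstants

section HolderEstimates

variable {X : Type*} [PseudoMetricSpace X] [MeasurableSpace X] {c : RegularityConstants}
  {μ : Measure X} {Q p ε : X → ℝ} {K : ℝ≥0} {S : Set X} {v : X → ℝ} {H : X → ℝ≥0} {κ : ℝ}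

theorem IsRegular.hasLogModulus_sub_div (h : IsRegular c μ Q p ε) :
    HasLogModulus (c.M + (c.A * c.M + 1 / c.a * c.M)) (fun x => ε x - Q x / p x) := by
  simp only [div_eq_mul_one_div (Q _)]
  refine h.ε_log.sub (h.Q_log.mul h.one_div_p_log (fun x => ?_) fun x => ?_)
  · rw [abs_of_pos (h.Q_pos x)]
    exact (h.Q_mem x).2
  · rw [abs_of_pos (one_div_pos.2 (h.p_pos x))]
    exact one_div_le_one_div_of_le c.a_pos (h.p_mem x).1

namespace HajlaszPair

theorem exists_abs_sub_le_limitConst [OpensMeasurableSpace X] (hp : HajlaszPair μ p ε K S v H)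
    (h : IsRegular c μ Q p ε) (hκ : 0 < κ) {x : X} (hgap : κ ≤ ε x * p x - Q x) (hx : x ∈ S)
    {r : ℝ} (hr : 0 < r) (hrR : r ≤ c.R) :
    ∃ y ∈ S, dist x y < r ∧ H y ≤ c.goodPointConst K * r ^ (-(Q x / p x)) ∧
      |v x - v y| ≤ c.limitConst K κ * r ^ (ε x - Q x / p x) := by
  obtain ⟨y, hy, hxy, hHy, chain⟩ := hp.exists_chain h hx hr hrR
  refine ⟨y, hy, hxy, hHy, ?_⟩
  have hC := c.chainConst_nonneg K
  have hε := h.ε_pos x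
  set β := ε x - Q x / p x
  have sum_le := sum_dyadic_rpow_le_first (div_pos hκ c.A_pos) (h.le_sub_div hκ.le hgap) hr.le
  have remainder_tendsto : Filter.Tendsto (fun J : ℕ => c.chainConst K *
      (geomConst (κ / c.A) * r ^ β + (r * (1 / 2 : ℝ) ^ J) ^ ε x * H x)) Filter.atTop
      (nhds (c.chainConst K * (geomConst (κ / c.A) * r ^ β + (r * 0) ^ ε x * H x))) := by
    have pow_tendsto : Filter.Tendsto (fun J : ℕ => (1 / 2 : ℝ) ^ J) Filter.atTop (nhds 0) :=
      tendsto_pow_atTop_nhds_zero_of_lt_one (by norm_num) (by norm_num)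
    exact ((((pow_tendsto.const_mul r).rpow_const (Or.inr hε.le)).mul_const _).const_add
      _).const_mul _
  rw [mul_zero, Real.zero_rpow hε.ne', zero_mul, add_zero, ← mul_assoc] at remainder_tendsto
  exact ge_of_tendsto' remainder_tendsto fun J => (chain J).trans (by gcongr; exact sum_le (J + 1))

theorem abs_sub_le_boundConst [OpensMeasurableSpace X] (hp : HajlaszPair μ p ε K S v H)
    (h : IsRegular c μ Q p ε) (hκ : 0 < κ) (hgap : ∀ x, κ ≤ ε x * p x - Q x) {x y : X}
    (hx : x ∈ S) (hy : y ∈ S) : |v x - v y| ≤ c.boundConst K κ := by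
  have hL := zero_le_one.trans (c.one_le_limitConst K hκ)
  have good_point : ∀ z ∈ S, ∃ z' ∈ S, H z' ≤ c.baseConst K ∧ |v z - v z'| ≤ c.limitConst K κ := by
    intro z hz
    obtain ⟨z', hz', -, hHz, hv⟩ :=
      hp.exists_abs_sub_le_limitConst h hκ (hgap z) hz c.R_pos le_rfl
    have hβ := (div_pos hκ c.A_pos).le.trans (h.le_sub_div hκ.le (hgap z))
    exact ⟨z', hz', hHz.trans (mul_le_mul_of_nonneg_left (h.rpow_neg_div_le z)
      (c.goodPointConst_nonneg K)), hv.trans (mul_le_of_le_one_right hL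
      (Real.rpow_le_one c.R_pos.le c.R_le_one hβ))⟩
  obtain ⟨x', hx', hHx, hvx⟩ := good_point x hx
  obtain ⟨y', hy', hHy, hvy⟩ := good_point y hy
  have hxy := hp.abs_sub_le_of_le h hx' hy' hHx hHy
  rw [abs_sub_comm] at hvy
  unfold RegularityConstants.boundConst
  linarith [abs_sub_le (v x) (v x') (v y), abs_sub_le (v x') (v y') (v y)]

theorem abs_sub_le_dist_rpow_of_dist_le [OpensMeasurableSpace X]
    (hp : HajlaszPair μ p ε K S v H) (h : IsRegular c μ Q p ε) (hκ : 0 < κ)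
    (hgap : ∀ x, κ ≤ ε x * p x - Q x) {x y : X} (hx : x ∈ S) (hy : y ∈ S) (hd : 0 < dist x y)
    (hdR : dist x y ≤ c.R) :
    |v x - v y| ≤ c.localHolderConst K κ * dist x y ^ (ε x - Q x / p x) := by
  set r := dist x y with hr
  have hr1 : r ≤ 1 := hdR.trans c.R_le_one
  obtain ⟨x', hx', hxx', hHx, hvx⟩ := hp.exists_abs_sub_le_limitConst h hκ (hgap x) hx hd hdR
  obtain ⟨y', hy', hyy', hHy, hvy⟩ := hp.exists_abs_sub_le_limitConst h hκ (hgap y) hy hd hdR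
  have hx'y' : dist x' y' ≤ 3 * r := by
    linarith [dist_triangle4 x' x y y', dist_comm x' x]
  have hE := c.scaleConst_nonneg
  have hT := c.goodPointConst_nonneg K
  have hL := c.one_le_limitConst K hκ
  have middle : |v x' - v y'| ≤ c.scaleConst * c.goodPointConst K *
      (r ^ (ε x - Q x / p x) + r ^ (ε y - Q y / p y)) := by
    calc |v x' - v y'| ≤ c.scaleConst * (r ^ ε x * H x' + r ^ ε y * H y') :=
          hp.abs_sub_le_near h hd hr1 hx' hy' hxx'.le hyy'.le hx'y'
      _ ≤ c.scaleConst * (r ^ ε x * (c.goodPointConst K * r ^ (-(Q x / p x))) +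
            r ^ ε y * (c.goodPointConst K * r ^ (-(Q y / p y)))) := by gcongr
      _ = _ := by
          simp only [sub_eq_add_neg, Real.rpow_add hd]
          ring
  have exponent_change := h.hasLogModulus_sub_div.rpow_le hd hr1 ((dist_comm y x).trans_le hr.ge)
  calc |v x - v y| ≤ |v x - v x'| + |v x' - v y'| + |v y - v y'| := by
        linarith [abs_sub_le (v x) (v x') (v y), abs_sub_le (v x') (v y') (v y),
          abs_sub_comm (v y) (v y')]
    _ ≤ (c.limitConst K κ + c.scaleConst * c.goodPointConst K) *
          (r ^ (ε x - Q x / p x) + r ^ (ε y - Q y / p y)) := by linarith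
    _ ≤ (c.limitConst K κ + c.scaleConst * c.goodPointConst K) * (r ^ (ε x - Q x / p x) +
          Real.exp (c.M + (c.A * c.M + 1 / c.a * c.M)) * r ^ (ε x - Q x / p x)) := by gcongr
    _ = _ := by
        unfold RegularityConstants.localHolderConst
        ring

theorem abs_sub_le_dist_rpow [OpensMeasurableSpace X] (hp : HajlaszPair μ p ε K S v H)
    (h : IsRegular c μ Q p ε) (hκ : 0 < κ) (hgap : ∀ x, κ ≤ ε x * p x - Q x) {x y : X}
    (hx : x ∈ S) (hy : y ∈ S) :
    |v x - v y| ≤ c.holderConst K κ * dist x y ^ (ε x - Q x / p x) := by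
  have hR := c.R_pos
  have hB := zero_le_one.trans (c.one_le_boundConst K hκ)
  have hL := c.localHolderConst_nonneg K hκ
  have hα := (div_pos hκ c.A_pos).le.trans (h.le_sub_div hκ.le (hgap x))
  rcases (dist_nonneg (x := x) (y := y)).eq_or_lt with hd | hd
  · have abs_le_zero := hp.pointwise_le x hx y hy
    rw [← hd, Real.zero_rpow (h.ε_pos x).ne', Real.zero_rpow (h.ε_pos y).ne', zero_mul, zero_mul,
      add_zero] at abs_le_zero
    have := zero_le_one.trans (c.one_le_holderConst K hκ)
    exact abs_le_zero.trans (by positivity)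
  have : 0 ≤ dist x y ^ (ε x - Q x / p x) := by positivity
  unfold RegularityConstants.holderConst
  rcases le_or_gt (dist x y) c.R with hdR | hdR
  · refine (hp.abs_sub_le_dist_rpow_of_dist_le h hκ hgap hx hy hd hdR).trans ?_
    gcongr
    exact le_add_of_nonneg_left (by positivity)
  · have hαA : ε x - Q x / p x ≤ c.A := by
      linarith [(h.ε_mem x).2, div_pos (h.Q_pos x) (h.p_pos x)]
    have one_le : 1 ≤ c.R ^ (-c.A) * dist x y ^ (ε x - Q x / p x) := by
      calc (1 : ℝ) = c.R ^ (-c.A) * c.R ^ c.A := by rw [← Real.rpow_add hR]; simp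
        _ ≤ c.R ^ (-c.A) * c.R ^ (ε x - Q x / p x) := mul_le_mul_of_nonneg_left
            (Real.rpow_le_rpow_of_exponent_ge hR c.R_le_one hαA) (by positivity)
        _ ≤ _ := by gcongr
    calc |v x - v y| ≤ c.boundConst K κ * 1 := by
          simpa using hp.abs_sub_le_boundConst h hκ hgap hx hy
      _ ≤ c.boundConst K κ * (c.R ^ (-c.A) * dist x y ^ (ε x - Q x / p x)) := by gcongr
      _ ≤ _ := by
          rw [add_mul, ← mul_assoc]
          exact le_add_of_nonneg_right (by positivity)

end HajlaszPair

end HolderEstimates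

section SupGradient

variable {X : Type*} {A κ : ℝ} {m : ℕ} {g : ℤ → X → ℝ≥0∞}

/-- A scalar gradient of smoothness lowered by `κ`, dominating a vector gradient of smoothness at
most `A` on a space of diameter less than `2 ^ m`, where only the indices `k ≥ -m` matter. -/
def supGradient (A κ : ℝ) (m : ℕ) (g : ℤ → X → ℝ≥0∞) (x : X) : ℝ≥0∞ :=
  ⨆ i : ℕ, ENNReal.ofReal (2 ^ (m * A - i * κ)) * g (i - m) x

theorem measurable_supGradient [MeasurableSpace X] (hg : ∀ k, Measurable (g k)) :
    Measurable (supGradient A κ m g) :=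
  Measurable.iSup fun _ => (hg _).const_mul _

theorem ofReal_rpow_mul_le_supGradient (hκ : 0 ≤ κ) {i : ℕ} {d σ τ : ℝ} (hd : 0 < d)
    (hdm : d ≤ 2 ^ ((m : ℝ) - i)) (hτ : 0 ≤ τ) (hσ : σ ≤ A) (hστ : κ ≤ σ - τ) (x : X) :
    ENNReal.ofReal (d ^ σ) * g (i - m) x ≤ ENNReal.ofReal (d ^ τ) * supGradient A κ m g x := by
  have gap_le : d ^ (σ - τ) ≤ 2 ^ (m * A - i * κ) := by
    calc d ^ (σ - τ) ≤ (2 ^ ((m : ℝ) - i)) ^ (σ - τ) := by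
          gcongr
          exact hκ.trans hστ
      _ = 2 ^ (m * (σ - τ) - i * (σ - τ)) := by
          rw [← Real.rpow_mul (by norm_num), sub_mul]
      _ ≤ 2 ^ (m * A - i * κ) := by
          gcongr
          · norm_num
          · linarith
  calc ENNReal.ofReal (d ^ σ) * g (i - m) x
      = ENNReal.ofReal (d ^ τ) * (ENNReal.ofReal (d ^ (σ - τ)) * g (i - m) x) := by
        rw [← mul_assoc, ← ENNReal.ofReal_mul (by positivity), ← Real.rpow_add hd, add_sub_cancel]
    _ ≤ ENNReal.ofReal (d ^ τ) * (ENNReal.ofReal (2 ^ (m * A - i * κ)) * g (i - m) x) := by gcongr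
    _ ≤ _ := by
        gcongr
        exact le_iSup (fun i : ℕ => ENNReal.ofReal (2 ^ (m * A - i * κ)) * g (i - m) x) i

theorem iSup_rpow_le_tsum {ι : Type*} (f : ι → ℝ≥0∞) {r : ℝ} (hr : 0 < r) :
    (⨆ i, f i) ^ r ≤ ∑' i, f i ^ r := by
  rw [← ENNReal.le_rpow_inv_iff hr]
  refine iSup_le fun i => ?_
  rw [ENNReal.le_rpow_inv_iff hr]
  exact ENNReal.le_tsum (f := fun i => f i ^ r) i

theorem supGradient_div_rpow_le {a : ℝ} (ha : 0 < a) (hκ : 0 ≤ κ) {t : ℝ} (ht : t ∈ Icc a A) (l : ℝ)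
    (x : X) :
    (supGradient A κ m g x / ENNReal.ofReal l) ^ t ≤
      ∑' i : ℕ, ENNReal.ofReal (2 ^ (m * A * A) * ((1 / 2) ^ (κ * a)) ^ i) *
        (g (i - m) x / ENNReal.ofReal l) ^ t := by
  have ht0 : 0 < t := ha.trans_le ht.1
  have weight_le : ∀ i : ℕ, ((2 : ℝ) ^ (m * A - i * κ)) ^ t ≤
      2 ^ (m * A * A) * ((1 / 2) ^ (κ * a)) ^ i := fun i => by
    have hA : 0 ≤ A := ht0.le.trans ht.2
    calc ((2 : ℝ) ^ (m * A - i * κ)) ^ t = 2 ^ (m * A * t - i * κ * t) := by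
          rw [← Real.rpow_mul (by norm_num), sub_mul]
      _ ≤ 2 ^ (m * A * A - i * κ * a) := by
          gcongr
          exacts [by norm_num, ht.2, ht.1]
      _ = 2 ^ (m * A * A) * ((1 / 2) ^ (κ * a)) ^ i := by
          rw [sub_eq_add_neg, Real.rpow_add (by norm_num), one_div, Real.inv_rpow (by norm_num),
            ← Real.rpow_neg (by norm_num), ← Real.rpow_natCast, ← Real.rpow_mul (by norm_num)]
          ring_nf
  rw [supGradient, ENNReal.iSup_div]
  refine (iSup_rpow_le_tsum _ ht0).trans (ENNReal.tsum_le_tsum fun i => ?_)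
  rw [mul_div_assoc, ENNReal.mul_rpow_of_nonneg _ _ ht0.le,
    ENNReal.ofReal_rpow_of_nonneg (by positivity) ht0.le]
  gcongr
  exact weight_le i

end SupGradient

section MixedNorm

variable {X : Type*} [MeasurableSpace X] {μ : Measure X} {p : X → ℝ} {q : X → ℝ≥0∞}
  {g : ℤ → X → ℝ≥0∞} {l : ℝ}

theorem IsExponent.exists_inv_le (hq : IsExponent μ q) :
    ∃ q₀ : ℝ, 0 < q₀ ∧ ∀ᵐ x ∂μ, ((q x)⁻¹).toReal ≤ 1 / q₀ := by
  have ne_top : min (essInf q μ) 1 ≠ ∞ := ne_top_of_le_ne_top ENNReal.one_ne_top (min_le_right _ _)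
  have pos : 0 < min (essInf q μ) 1 := lt_min hq.essInf_pos one_pos
  refine ⟨(min (essInf q μ) 1).toReal, ENNReal.toReal_pos pos.ne' ne_top, ?_⟩
  filter_upwards [ae_essInf_le (f := q) (μ := μ)] with x hx
  rw [one_div, ← ENNReal.toReal_inv]
  apply ENNReal.toReal_mono (ENNReal.inv_ne_top.2 pos.ne')
  exact ENNReal.inv_le_inv.2 ((min_le_left _ _).trans hx)

theorem modular_mono {f f' : X → ℝ≥0∞} (hp : ∀ x, 0 < p x) (h : ∀ᵐ x ∂μ, f x ≤ f' x) :
    modular μ p f ≤ modular μ p f' := by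
  apply lintegral_mono_ae
  filter_upwards [h] with x hx
  exact ENNReal.rpow_le_rpow hx (hp x).le

theorem div_ofReal_div_ofReal (a : ℝ≥0∞) {s : ℝ} (hs : 0 < s) (t : ℝ) :
    a / ENNReal.ofReal s / ENNReal.ofReal t = a / ENNReal.ofReal (s * t) := by
  rw [ENNReal.ofReal_mul hs.le, div_eq_mul_inv, div_eq_mul_inv, div_eq_mul_inv,
    ENNReal.mul_inv (Or.inl (by simpa using hs)) (Or.inl ENNReal.ofReal_ne_top), mul_assoc]

theorem modular_div_le_one_of_mixedNorm_lt (hp : ∀ x, 0 < p x) (hq : IsExponent μ q)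
    (h : mixedNorm μ p q g < ENNReal.ofReal l) (k : ℤ) :
    modular μ p (fun x => g k x / ENNReal.ofReal l) ≤ 1 := by
  obtain ⟨q₀, hq₀, hqx⟩ := hq.exists_inv_le
  simp only [mixedNorm, iInf_lt_iff] at h
  obtain ⟨l', hl', hmod, hll⟩ := h
  have one_lt_quot : 1 < l / l' :=
    (one_lt_div hl').2 ((ENNReal.ofReal_lt_ofReal_iff_of_nonneg hl'.le).1 hll)
  have one_lt_pow : 1 < (l / l') ^ q₀ := Real.one_lt_rpow one_lt_quot hq₀
  have hk := ((ENNReal.le_tsum k).trans hmod).trans_lt (ENNReal.one_lt_ofReal.2 one_lt_pow)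
  simp only [iInf_lt_iff] at hk
  obtain ⟨t, ht, hmt, htη⟩ := hk
  have t_lt : t < (l / l') ^ q₀ := (ENNReal.ofReal_lt_ofReal_iff_of_nonneg ht.le).1 htη
  refine (modular_mono hp ?_).trans hmt
  filter_upwards [hqx] with x hx
  rw [div_ofReal_div_ofReal _ hl']
  refine ENNReal.div_le_div_left (ENNReal.ofReal_le_ofReal ?_) _
  calc l' * t ^ ((q x)⁻¹).toReal ≤ l' * ((l / l') ^ q₀) ^ ((q x)⁻¹).toReal := by gcongr
    _ ≤ l' * ((l / l') ^ q₀) ^ (1 / q₀) := by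
        gcongr
        exact one_lt_pow.le
    _ = l := by
        rw [← Real.rpow_mul (by positivity), mul_one_div_cancel hq₀.ne', Real.rpow_one,
          mul_div_cancel₀ _ hl'.ne']

theorem exists_mixedModular_div_le (hp : ∀ x, 0 < p x) (hq : IsExponent μ q) :
    ∃ q₀ : ℝ, 0 < q₀ ∧ ∀ (g : ℤ → X → ℝ≥0∞) (N : ℝ), 1 ≤ N →
      mixedModular μ p q (fun k x => g k x / ENNReal.ofReal (N ^ (1 / q₀))) * ENNReal.ofReal N ≤
        mixedModular μ p q g := by
  obtain ⟨q₀, hq₀, hqx⟩ := hq.exists_inv_le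
  refine ⟨q₀, hq₀, fun g N hN => ?_⟩
  have hN0 : 0 < N := one_pos.trans_le hN
  unfold mixedModular
  rw [← ENNReal.tsum_mul_right]
  refine ENNReal.tsum_le_tsum fun k => le_iInf fun t => le_iInf fun ht => le_iInf fun hmt => ?_
  have ofReal_eq : ENNReal.ofReal t = ENNReal.ofReal (t / N) * ENNReal.ofReal N := by
    rw [← ENNReal.ofReal_mul (by positivity), div_mul_cancel₀ _ hN0.ne']
  rw [ofReal_eq]
  gcongr
  refine iInf_le_of_le (t / N) (iInf_le_of_le (by positivity) (iInf_le_of_le ?_ le_rfl))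
  refine (modular_mono hp ?_).trans hmt
  filter_upwards [hqx] with x hx
  rw [div_ofReal_div_ofReal _ (by positivity)]
  refine ENNReal.div_le_div_left (ENNReal.ofReal_le_ofReal ?_) _
  calc t ^ ((q x)⁻¹).toReal = N ^ ((q x)⁻¹).toReal * (t / N) ^ ((q x)⁻¹).toReal := by
        rw [← Real.mul_rpow hN0.le (by positivity), mul_div_cancel₀ _ hN0.ne']
    _ ≤ N ^ (1 / q₀) * (t / N) ^ ((q x)⁻¹).toReal := by gcongr

theorem MemMixed.mixedNorm_lt_top (hp : ∀ x, 0 < p x) (hq : IsExponent μ q)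
    (hg : MemMixed μ p q g) : mixedNorm μ p q g < ∞ := by
  obtain ⟨q₀, -, scaling⟩ := exists_mixedModular_div_le hp hq
  obtain ⟨l, hl, hfin⟩ := hg.2
  set V := mixedModular μ p q (fun k x => g k x / ENNReal.ofReal l)
  have hN : 0 < max 1 V.toReal := one_pos.trans_le (le_max_left _ _)
  have V_le : V ≤ ENNReal.ofReal (max 1 V.toReal) := by
    calc V = ENNReal.ofReal V.toReal := (ENNReal.ofReal_toReal hfin.ne).symm
      _ ≤ ENNReal.ofReal (max 1 V.toReal) := ENNReal.ofReal_le_ofReal (le_max_right _ _)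
  have scaled_le_one :=
    (scaling _ _ (le_max_left 1 V.toReal)).trans (V_le.trans_eq (one_mul _).symm)
  rw [ENNReal.mul_le_mul_iff_left (ENNReal.ofReal_pos.2 hN).ne' ENNReal.ofReal_ne_top]
    at scaled_le_one
  simp only [div_ofReal_div_ofReal _ hl] at scaled_le_one
  refine lt_of_le_of_lt ?_ (ENNReal.ofReal_lt_top (r := l * max 1 V.toReal ^ (1 / q₀)))
  exact iInf_le_of_le _ (iInf_le_of_le (by positivity) (iInf_le_of_le scaled_le_one le_rfl))

variable {a A κ : ℝ} {m : ℕ}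

theorem modular_supGradient_div_le (ha : 0 < a) (hκ : 0 < κ) (hpm : Measurable p)
    (hp : ∀ x, p x ∈ Icc a A) (hg : ∀ k, Measurable (g k))
    (h : ∀ k, modular μ p (fun x => g k x / ENNReal.ofReal l) ≤ 1) :
    modular μ p (fun x => supGradient A κ m g x / ENNReal.ofReal l) ≤
      ENNReal.ofReal (2 ^ (m * A * A) * geomConst (κ * a)) := by
  have hθ := half_rpow_lt_one (mul_pos hκ ha)
  have hmeas : ∀ k, Measurable fun x => (g k x / ENNReal.ofReal l) ^ p x :=
    fun k => ((hg k).div_const _).pow hpm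
  calc modular μ p (fun x => supGradient A κ m g x / ENNReal.ofReal l)
      ≤ ∫⁻ x, ∑' i : ℕ, ENNReal.ofReal (2 ^ (m * A * A) * ((1 / 2) ^ (κ * a)) ^ i) *
          (g (i - m) x / ENNReal.ofReal l) ^ p x ∂μ :=
        lintegral_mono fun x => supGradient_div_rpow_le ha hκ.le (hp x) l x
    _ = ∑' i : ℕ, ENNReal.ofReal (2 ^ (m * A * A) * ((1 / 2) ^ (κ * a)) ^ i) *
          modular μ p (fun x => g (i - m) x / ENNReal.ofReal l) := by
        rw [lintegral_tsum fun i => ((hmeas _).const_mul _).aemeasurable]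
        simp only [lintegral_const_mul _ (hmeas _), modular]
    _ ≤ ∑' i : ℕ, ENNReal.ofReal (2 ^ (m * A * A) * ((1 / 2) ^ (κ * a)) ^ i) :=
        ENNReal.tsum_le_tsum fun i => mul_le_of_le_one_right' (h _)
    _ = ENNReal.ofReal (2 ^ (m * A * A) * geomConst (κ * a)) := by
        rw [← ENNReal.ofReal_tsum_of_nonneg (fun i => by positivity)
          ((summable_geometric_of_lt_one (by positivity) hθ).mul_left _), tsum_mul_left,
          tsum_geometric_of_lt_one (by positivity) hθ, geomConst]

end MixedNorm

section Reduction

variable {X : Type*} [MeasurableSpace X] {μ : Measure X} {p : X → ℝ}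

theorem ae_lt_top_of_modular_div_lt_top (hpm : Measurable p) (hp : ∀ x, 0 < p x)
    {F : X → ℝ≥0∞} (hF : Measurable F) {l : ℝ}
    (h : modular μ p (fun x => F x / ENNReal.ofReal l) < ∞) : ∀ᵐ x ∂μ, F x < ∞ := by
  filter_upwards [ae_lt_top ((hF.div_const (ENNReal.ofReal l)).pow hpm) h.ne] with x hx
  by_contra hc
  rw [not_lt, top_le_iff] at hc
  simp only [hc, ENNReal.top_div_of_ne_top ENNReal.ofReal_ne_top,
    ENNReal.top_rpow_of_pos (hp x), lt_self_iff_false] at hx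

theorem abs_toReal_sub_toReal_le {a b : EReal} (ha : a ≠ ⊤ ∧ a ≠ ⊥) (hb : b ≠ ⊤ ∧ b ≠ ⊥)
    {t : ℝ≥0} (h : (a - b).abs ≤ t) : |a.toReal - b.toReal| ≤ t := by
  lift a to ℝ using ha
  lift b to ℝ using hb
  rw [← EReal.coe_sub, EReal.abs_def] at h
  simpa [ENNReal.ofReal_le_iff_le_toReal] using h

theorem exists_dyadic_index {d : ℝ} (hd : 0 < d) {m : ℕ} (hdm : d < 2 ^ m) :
    ∃ i : ℕ, (2 : ℝ) ^ (-(i - m : ℤ) - 1) ≤ d ∧ d < 2 ^ (-(i - m : ℤ)) := by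
  obtain ⟨n, hn_le, hn_lt⟩ := exists_mem_Ico_zpow hd (by norm_num : (1 : ℝ) < 2)
  have hnm : n < m := by
    have : (2 : ℝ) ^ n < 2 ^ (m : ℤ) := hn_le.trans_lt (by exact_mod_cast hdm)
    exact (zpow_lt_zpow_iff_right₀ (by norm_num)).1 this
  obtain ⟨i, hi⟩ : ∃ i : ℕ, (i : ℤ) = m - n - 1 := ⟨(m - n - 1 : ℤ).toNat, by lia⟩
  refine ⟨i, ?_, ?_⟩
  · rwa [show -(i - m : ℤ) - 1 = n by lia]
  · rwa [show -(i - m : ℤ) = n + 1 by lia]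

theorem IsVectorGradient.exists_abs_sub_le_supGradient {X : Type u} [MetricSpace X]
    [MeasurableSpace X] {μ : Measure X} {s ε : X → ℝ} {u : X → EReal} {g : ℤ → X → ℝ≥0∞}
    (hg : IsVectorGradient μ s u g) {A κ : ℝ} {m : ℕ} (hm : ∀ x y : X, dist x y < 2 ^ m)
    (hκ : 0 ≤ κ) (hsA : ∀ x, s x ≤ A) (hε : ∀ x, 0 ≤ ε x) (hgap : ∀ x, κ ≤ s x - ε x) :
    ∃ N : Set X, μ N = 0 ∧ ∀ x ∉ N, ∀ y ∉ N, x ≠ y → (u x - u y).abs ≤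
      ENNReal.ofReal (dist x y ^ ε x) * supGradient A κ m g x +
        ENNReal.ofReal (dist x y ^ ε y) * supGradient A κ m g y := by
  obtain ⟨-, N, hN, gradient_le⟩ := hg
  refine ⟨N, hN, fun x hx y hy hxy => ?_⟩
  have hd := dist_pos.2 hxy
  obtain ⟨i, hi_le, hi_lt⟩ := exists_dyadic_index hd (hm x y)
  have hdi : dist x y ≤ 2 ^ ((m : ℝ) - i) := by
    rw [← Real.rpow_intCast] at hi_lt
    push_cast at hi_lt
    rw [neg_sub] at hi_lt
    exact hi_lt.le
  exact (gradient_le _ x y hx hy hi_le hi_lt).trans (add_le_add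
    (ofReal_rpow_mul_le_supGradient hκ hd hdi (hε x) (hsA x) (hgap x) x)
    (ofReal_rpow_mul_le_supGradient hκ hd hdi (hε y) (hsA y) (hgap y) y))

end Reduction

section Setting

variable {X : Type u} [MetricSpace X] [MeasurableSpace X] {μ : Measure X} {a A L : ℝ}
  {f : X → ℝ}

theorem forall_le_of_ae_le {X : Type*} [TopologicalSpace X] [MeasurableSpace X]
    {μ : Measure X} [μ.IsOpenPosMeasure] {f g : X → ℝ} (hf : Continuous f) (hg : Continuous g)
    (h : ∀ᵐ x ∂μ, f x ≤ g x) (x : X) : f x ≤ g x := by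
  have : min f g = f := (hf.min hg).ae_eq_iff_eq μ hf |>.1 <| by
    filter_upwards [h] with y hy using min_eq_left hy
  exact this ▸ min_le_right (f x) (g x)

namespace IsLogExponent

theorem continuous (hf : IsLogExponent μ a A L f) : Continuous f := by
  have : Continuous fun x => 1 / (1 / f x) :=
    continuous_const.div hf.logHolder.hasLogModulus.continuous
      fun x => (one_div_pos.2 (hf.pos x)).ne'
  simpa using this

theorem mem_Icc [μ.IsOpenPosMeasure] (hf : IsLogExponent μ a A L f) (x : X) :
    f x ∈ Icc a (max A 1) :=
  ⟨forall_le_of_ae_le continuous_const hf.continuous hf.ess_lower x,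
    (forall_le_of_ae_le hf.continuous continuous_const hf.ess_upper x).trans (le_max_left _ _)⟩

theorem hasLogModulus [μ.IsOpenPosMeasure] (hf : IsLogExponent μ a A L f) :
    HasLogModulus (max A 1 * max A 1 * max L 0) f :=
  hf.logHolder.hasLogModulus.of_one_div hf.pos fun x => (hf.mem_Icc x).2

end IsLogExponent

/-- The regularity constants determined by the data of a `Setting`. -/
def settingConstants {b δ a : ℝ} (hb : 0 < b) (hδ : 0 < δ) (ha : 0 < a) (D A L : ℝ) :
    RegularityConstants where
  b := b
  R := min δ 1
  D := max D 1
  a := a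
  A := max A 1
  M := max A 1 * max A 1 * max L 0
  b_pos := hb
  R_pos := lt_min hδ one_pos
  R_le_one := min_le_right _ _
  one_le_D := le_max_right _ _
  a_pos := ha
  one_le_A := le_max_right _ _
  M_nonneg := by positivity

/-- A bound for the modular of the normalized scalar gradient obtained from a vector gradient. -/
def gradientModularConst (D a A κ : ℝ) : ℝ≥0 :=
  Real.toNNReal (2 ^ (⌈D⌉₊ * max A 1 * max A 1) * geomConst (κ * a))

namespace Setting

variable [BorelSpace X] {b δ D κ l : ℝ} {Q p s ε : X → ℝ} {q : X → ℝ≥0∞} {u : X → EReal}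
  {g : ℤ → X → ℝ≥0∞}

theorem isOpenPosMeasure (hs : Setting μ b δ D a A L κ Q p s ε) : μ.IsOpenPosMeasure := by
  refine ⟨fun U hU ⟨x, hx⟩ => ?_⟩
  obtain ⟨r, hr, hball⟩ := Metric.isOpen_iff.1 hU x hx
  exact ((hs.ball_pos x r hr).trans_le (measure_mono hball)).ne'

theorem measure_univ_lt_top (hs : Setting μ b δ D a A L κ Q p s ε) : μ univ < ∞ := by
  rcases isEmpty_or_nonempty X with hX | ⟨⟨x⟩⟩
  · simp [univ_eq_empty_iff.2 hX]
  · obtain ⟨r, hr, h⟩ := hs.bounded.subset_ball_lt 0 x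
    exact (measure_mono h).trans_lt (hs.ball_lt_top x r hr)

theorem dist_le (hs : Setting μ b δ D a A L κ Q p s ε) (x y : X) : dist x y ≤ D :=
  hs.diam_eq ▸ Metric.dist_le_diam_of_mem hs.bounded (mem_univ x) (mem_univ y)

theorem isRegular (hs : Setting μ b δ D a A L κ Q p s ε) (hb : 0 < b) (hδ : 0 < δ)
    (ha : 0 < a) : IsRegular (settingConstants hb hδ ha D A L) μ Q p ε := by
  have := hs.isOpenPosMeasure
  have L_le : max L 0 ≤ max A 1 * max A 1 * max L 0 := le_mul_of_one_le_left (le_max_right _ _)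
    (one_le_mul_of_one_le_of_one_le (le_max_right _ _) (le_max_right _ _))
  exact
    { dist_le := fun x y => (hs.dist_le x y).trans (le_max_left _ _)
      measure_univ_lt_top := hs.measure_univ_lt_top
      lower_regular := fun x r hr hrR => hs.lower_regular x r hr (hrR.trans (min_le_left _ _))
      measurable_p := hs.exponent_p.measurable
      Q_mem := hs.exponent_Q.mem_Icc
      p_mem := hs.exponent_p.mem_Icc
      ε_mem := hs.exponent_ε.mem_Icc
      Q_log := hs.exponent_Q.hasLogModulus
      one_div_p_log := hs.exponent_p.logHolder.hasLogModulus.mono L_le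
      ε_log := hs.exponent_ε.hasLogModulus }

theorem le_sub (hs : Setting μ b δ D a A L κ Q p s ε) (x : X) : κ ≤ s x - ε x :=
  have := hs.isOpenPosMeasure
  forall_le_of_ae_le continuous_const (hs.exponent_s.continuous.sub hs.exponent_ε.continuous)
    hs.gap x

theorem modular_supGradient_div_le (hs : Setting μ b δ D a A L κ Q p s ε) (ha : 0 < a)
    (hκ : 0 < κ) (hq : IsExponent μ q) (hg : ∀ k, Measurable (g k))
    (hl : mixedNorm μ p q g < ENNReal.ofReal l) :
    modular μ p (fun x => supGradient (max A 1) κ ⌈D⌉₊ g x / ENNReal.ofReal l) ≤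
      gradientModularConst D a A κ :=
  have := hs.isOpenPosMeasure
  VarBesov.modular_supGradient_div_le ha hκ hs.exponent_p.measurable hs.exponent_p.mem_Icc hg
    (modular_div_le_one_of_mixedNorm_lt hs.exponent_p.pos hq hl)

theorem ae_supGradient_lt_top (hs : Setting μ b δ D a A L κ Q p s ε) (ha : 0 < a)
    (hκ : 0 < κ) (hq : IsExponent μ q) (hg : ∀ k, Measurable (g k)) (hmem : MemMixed μ p q g) :
    ∀ᵐ x ∂μ, supGradient (max A 1) κ ⌈D⌉₊ g x < ∞ := by
  have norm_lt : mixedNorm μ p q g < ENNReal.ofReal ((mixedNorm μ p q g).toReal + 1) :=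
    (ENNReal.lt_ofReal_iff_toReal_lt (hmem.mixedNorm_lt_top hs.exponent_p.pos hq).ne).2
      (lt_add_one _)
  exact ae_lt_top_of_modular_div_lt_top hs.exponent_p.measurable hs.exponent_p.pos
    (measurable_supGradient hg)
    ((hs.modular_supGradient_div_le ha hκ hq hg norm_lt).trans_lt ENNReal.coe_lt_top)

theorem exists_hajlaszPair (hs : Setting μ b δ D a A L κ Q p s ε) (ha : 0 < a) (hκ : 0 < κ)
    (hq : IsExponent μ q) (hu : MeasFiniteAE μ u) (hg : IsVectorGradient μ s u g)
    (hmem : MemMixed μ p q g) :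
    ∃ S : Set X, (∀ x ∈ S, u x = ((u x).toReal : EReal)) ∧
      ∀ l : ℝ, mixedNorm μ p q g < ENNReal.ofReal l →
        ∃ H, HajlaszPair μ p ε (gradientModularConst D a A κ) S (fun x => (u x).toReal / l) H := by
  have := hs.isOpenPosMeasure
  set G := supGradient (max A 1) κ ⌈D⌉₊ g
  have hG : Measurable G := measurable_supGradient hg.1
  have dist_lt : ∀ x y : X, dist x y < 2 ^ ⌈D⌉₊ := fun x y =>
    ((hs.dist_le x y).trans (Nat.le_ceil D)).trans_lt (by exact_mod_cast Nat.lt_two_pow_self)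
  obtain ⟨N, hN, gradient_le⟩ := hg.exists_abs_sub_le_supGradient dist_lt hκ.le
    (fun x => (hs.exponent_s.mem_Icc x).2) (fun x => (hs.exponent_ε.pos x).le) hs.le_sub
  refine ⟨{x | x ∉ N ∧ (u x ≠ ⊤ ∧ u x ≠ ⊥) ∧ G x < ∞},
    fun x hx => (EReal.coe_toReal hx.2.1.1 hx.2.1.2).symm, fun l hl => ?_⟩
  have hl0 : 0 < l := ENNReal.ofReal_pos.1 (bot_le.trans_lt hl)
  refine ⟨fun x => (G x / ENNReal.ofReal l).toNNReal, ?_, ?_, ?_, ?_⟩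
  · exact (hG.div_const _).ennreal_toNNReal
  · filter_upwards [measure_eq_zero_iff_ae_notMem.1 hN, hu.2,
      hs.ae_supGradient_lt_top ha hκ hq hg.1 hmem] with x hxN hxu hxG using ⟨hxN, hxu, hxG⟩
  · rintro x ⟨hxN, hxu, hxG⟩ y ⟨hyN, hyu, hyG⟩
    rcases eq_or_ne x y with rfl | hxy
    · rw [sub_self, abs_zero]
      positivity
    have oscillation_le : |(u x).toReal - (u y).toReal| ≤
        dist x y ^ ε x * (G x).toReal + dist x y ^ ε y * (G y).toReal := by
      refine (abs_toReal_sub_toReal_le hxu hyu (t := Real.toNNReal (dist x y ^ ε x) *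
        (G x).toNNReal + Real.toNNReal (dist x y ^ ε y) * (G y).toNNReal) ?_).trans_eq ?_
      · simpa [ENNReal.coe_toNNReal, hxG.ne, hyG.ne, ENNReal.ofReal] using
          gradient_le x hxN y hyN hxy
      · simp [Real.coe_toNNReal _ (Real.rpow_nonneg dist_nonneg _), ENNReal.coe_toNNReal_eq_toReal]
    rw [← sub_div, abs_div, abs_of_pos hl0, div_le_iff₀ hl0]
    refine oscillation_le.trans_eq ?_
    simp only [ENNReal.coe_toNNReal_eq_toReal, ENNReal.toReal_div,
      ENNReal.toReal_ofReal hl0.le]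
    field_simp
  · exact (modular_mono hs.exponent_p.pos (ae_of_all _ fun x => ENNReal.coe_toNNReal_le_self)).trans
      (hs.modular_supGradient_div_le ha hκ hq hg.1 hl)

end Setting

end Setting

section Luxemburg

variable {X : Type*} [MeasurableSpace X] {μ : Measure X} {p : X → ℝ}

theorem le_ofReal_mul_of_forall_lt {F N : ℝ≥0∞} {C : ℝ} (hC : 0 < C)
    (h : ∀ l : ℝ, N < ENNReal.ofReal l → F ≤ ENNReal.ofReal (l * C)) :
    F ≤ ENNReal.ofReal C * N := by
  have ofReal_ne_zero : ENNReal.ofReal C ≠ 0 := (ENNReal.ofReal_pos.2 hC).ne'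
  rw [mul_comm, ← ENNReal.div_le_iff ofReal_ne_zero ENNReal.ofReal_ne_top]
  refine le_of_forall_gt fun t ht => ?_
  obtain ⟨l, hl, hNl, hlt⟩ := ENNReal.lt_iff_exists_real_btwn.1 ht
  refine lt_of_le_of_lt ?_ hlt
  rw [ENNReal.div_le_iff ofReal_ne_zero ENNReal.ofReal_ne_top, ← ENNReal.ofReal_mul hl]
  exact h l hNl

theorem luxNorm_le {f : X → ℝ≥0∞} {l : ℝ} (hl : 0 < l)
    (h : modular μ p (fun x => f x / ENNReal.ofReal l) ≤ 1) : luxNorm μ p f ≤ ENNReal.ofReal l :=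
  iInf_le_of_le l (iInf_le_of_le hl (iInf_le_of_le h le_rfl))

theorem modular_div_le_one_of_luxNorm_lt (hp : ∀ x, 0 < p x) {f : X → ℝ≥0∞} {l : ℝ}
    (h : luxNorm μ p f < ENNReal.ofReal l) :
    modular μ p (fun x => f x / ENNReal.ofReal l) ≤ 1 := by
  simp only [luxNorm, iInf_lt_iff] at h
  obtain ⟨l', -, hmod, hll⟩ := h
  exact (modular_mono hp (ae_of_all _ fun x => ENNReal.div_le_div_left hll.le _)).trans hmod

theorem modular_max_le (hpm : Measurable p) {f : X → ℝ≥0∞} (hf : Measurable f)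
    (f' : X → ℝ≥0∞) :
    modular μ p (fun x => max (f x) (f' x)) ≤ modular μ p f + modular μ p f' := by
  unfold modular
  rw [← lintegral_add_left (hf.pow hpm)]
  refine lintegral_mono fun x => ?_
  rcases max_choice (f x) (f' x) with h | h
  · simp only [h, le_self_add]
  · simp only [h, le_add_self]

theorem modular_max_one_le (hpm : Measurable p) (f : X → ℝ≥0∞) :
    modular μ p (fun x => max 1 (f x)) ≤ μ univ + modular μ p f :=
  (modular_max_le hpm measurable_const f).trans_eq (by simp [modular])

theorem modular_div_rpow_le_one {a N : ℝ} (ha : 0 < a) (hp : ∀ x, a ≤ p x) (hN : 1 ≤ N)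
    {f : X → ℝ≥0∞} (h : modular μ p f ≤ ENNReal.ofReal N) :
    modular μ p (fun x => f x / ENNReal.ofReal (N ^ (1 / a))) ≤ 1 := by
  have hN0 : 0 < N := one_pos.trans_le hN
  have N_le : ∀ x, N ≤ (N ^ (1 / a)) ^ p x := fun x => by
    rw [← Real.rpow_mul hN0.le, one_div_mul_eq_div]
    exact Real.self_le_rpow_of_one_le hN ((one_le_div ha).2 (hp x))
  calc modular μ p (fun x => f x / ENNReal.ofReal (N ^ (1 / a)))
      ≤ ∫⁻ x, f x ^ p x * (ENNReal.ofReal N)⁻¹ ∂μ := by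
        refine lintegral_mono fun x => ?_
        have hpx : 0 ≤ p x := ha.le.trans (hp x)
        rw [ENNReal.div_rpow_of_nonneg _ _ hpx,
          ENNReal.ofReal_rpow_of_nonneg (by positivity) hpx, div_eq_mul_inv]
        gcongr
        exact N_le x
    _ = modular μ p f * (ENNReal.ofReal N)⁻¹ := lintegral_mul_const' _ _ (by simpa using hN0)
    _ ≤ 1 := by
        rw [← div_eq_mul_inv]
        exact ENNReal.div_le_of_le_mul (by rwa [one_mul])

/-- The Sobolev exponent `γ_ε = Q p / (Q - ε p)` of the subcritical case. -/
def sobolevExponent (Q p ε : X → ℝ) (x : X) : ℝ := Q x * p x / (Q x - ε x * p x)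

end Luxemburg

section Average

variable {X : Type*} [MeasurableSpace X] {μ : Measure X} [IsFiniteMeasure μ] {f : X → ℝ}
  {c B : ℝ}

theorem integrable_of_lintegral_enorm_sub_le (hf : AEStronglyMeasurable f μ)
    (h : ∫⁻ x, ‖f x - c‖ₑ ∂μ ≤ ENNReal.ofReal B * μ univ) : Integrable f μ := by
  have : Integrable (fun x => f x - c) μ :=
    ⟨hf.sub aestronglyMeasurable_const,
      h.trans_lt (ENNReal.mul_lt_top ENNReal.ofReal_lt_top (measure_lt_top _ _))⟩
  exact (this.add (integrable_const c)).congr (ae_of_all _ fun x => sub_add_cancel _ _)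

theorem abs_average_sub_le [NeZero μ] (hB : 0 ≤ B) (hf : Integrable f μ)
    (h : ∫⁻ x, ‖f x - c‖ₑ ∂μ ≤ ENNReal.ofReal B * μ univ) : |⨍ x, f x ∂μ - c| ≤ B := by
  have average_sub : ⨍ x, f x ∂μ - c = ⨍ x, (f x - c) ∂μ := by
    rw [average, average, integral_sub hf.to_average (integrable_const c), integral_const]
    simp
  have : ‖⨍ x, (f x - c) ∂μ‖ₑ ≤ ENNReal.ofReal B := by
    refine (enorm_integral_le_lintegral_enorm _).trans ?_
    rw [lintegral_smul_measure, smul_eq_mul, mul_comm, ← div_eq_mul_inv]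
    exact ENNReal.div_le_of_le_mul h
  rw [average_sub]
  rwa [Real.enorm_eq_ofReal_abs, ENNReal.ofReal_le_ofReal_iff hB] at this

end Average

namespace RegularityConstants

variable (c : RegularityConstants) (K : ℝ≥0)

/-- The constant in the Sobolev and Sobolev–Poincaré inequalities on a space of measure `m`. -/
def sobolevConst (κ : ℝ) (m : ℝ≥0) : ℝ :=
  (c.subcriticalConst K (c.baseConst (K + 1)) κ + c.baseConst (K + 1)) *
    (m + K + 1) ^ (1 / c.a)

theorem sobolevConst_pos {κ : ℝ} (hκ : 0 < κ) (m : ℝ≥0) : 0 < c.sobolevConst K κ m := by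
  have := c.baseConst_nonneg (K + 1)
  have := one_pos.trans_le (c.one_le_subcriticalConst K this hκ)
  unfold sobolevConst
  positivity

end RegularityConstants

section Subcritical

variable {X : Type*} [PseudoMetricSpace X] [MeasurableSpace X] {c : RegularityConstants}
  {μ : Measure X} {Q p ε : X → ℝ} {K : ℝ≥0} {S : Set X} {v : X → ℝ} {H : X → ℝ≥0} {κ : ℝ}

theorem ofReal_mul_max_one_rpow {C : ℝ} (hC : 0 ≤ C) (t : ℝ≥0) (r : ℝ) :
    ENNReal.ofReal (C * max 1 (t : ℝ) ^ r) = ENNReal.ofReal C * max 1 (t : ℝ≥0∞) ^ r := by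
  have : 0 < max 1 (t : ℝ) := one_pos.trans_le (le_max_left _ _)
  rw [ENNReal.ofReal_mul hC, ← ENNReal.ofReal_rpow_of_pos this, ENNReal.ofReal_max,
    ENNReal.ofReal_one, ENNReal.ofReal_coe_nnreal]

namespace IsRegular

theorem le_sobolevExponent (h : IsRegular c μ Q p ε) {x : X} (hgap : 0 < Q x - ε x * p x) :
    c.a ≤ sobolevExponent Q p ε x := by
  refine (h.p_mem x).1.trans ((le_div_iff₀ hgap).2 ?_)
  nlinarith [mul_pos (mul_pos (h.ε_pos x) (h.p_pos x)) (h.p_pos x)]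

theorem modular_sobolevExponent_rpow (h : IsRegular c μ Q p ε)
    (hgap : ∀ x, 0 < Q x - ε x * p x) (f : X → ℝ≥0∞) :
    modular μ (sobolevExponent Q p ε) (fun x => f x ^ (1 - ε x * p x / Q x)) =
      modular μ p f := by
  refine lintegral_congr fun x => ?_
  have := (h.Q_pos x).ne'
  have := (hgap x).ne'
  rw [← ENNReal.rpow_mul, sobolevExponent]
  congr 1
  field_simp

theorem luxNorm_sobolevExponent_le (h : IsRegular c μ Q p ε)
    (hgap : ∀ x, 0 < Q x - ε x * p x) {l C N : ℝ} (hl : 0 < l) (hC : 0 < C) (hN : 1 ≤ N)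
    {f t : X → ℝ≥0∞} (ht : modular μ p t ≤ ENNReal.ofReal N)
    (hf : ∀ᵐ x ∂μ, f x / ENNReal.ofReal l ≤ ENNReal.ofReal C * t x ^ (1 - ε x * p x / Q x)) :
    luxNorm μ (sobolevExponent Q p ε) f ≤ ENNReal.ofReal (l * (C * N ^ (1 / c.a))) := by
  have le_exponent : ∀ x, c.a ≤ sobolevExponent Q p ε x := fun x => h.le_sobolevExponent (hgap x)
  refine luxNorm_le (by positivity) ((modular_mono (fun x => c.a_pos.trans_le (le_exponent x))
    ?_).trans (modular_div_rpow_le_one c.a_pos le_exponent hN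
      ((h.modular_sobolevExponent_rpow hgap t).trans_le ht)))
  filter_upwards [hf] with x hx
  rw [← div_ofReal_div_ofReal _ hl, ← div_ofReal_div_ofReal _ hC]
  exact ENNReal.div_le_div_right (ENNReal.div_le_of_le_mul' hx) _

end IsRegular

namespace HajlaszPair

theorem modular_max_one_le (hp : HajlaszPair μ p ε K S v H) (hpm : Measurable p) :
    modular μ p (fun x => max 1 (H x : ℝ≥0∞)) ≤ μ univ + K :=
  (VarBesov.modular_max_one_le hpm _).trans (by gcongr; exact hp.modular_le)

theorem luxNorm_le_sobolevConst (hp : HajlaszPair μ p ε K S v H) (h : IsRegular c μ Q p ε)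
    (hκ : 0 < κ) (hgap : ∀ x, κ ≤ Q x - ε x * p x) {m : ℝ≥0} (hm : μ univ = m) {l : ℝ}
    (hl : 0 < l) {f : X → ℝ≥0∞}
    (hf : ∀ x ∈ S, f x / ENNReal.ofReal l ≤
      ENNReal.ofReal ((c.subcriticalConst K (c.baseConst (K + 1)) κ + c.baseConst (K + 1)) *
        max 1 (H x : ℝ) ^ (1 - ε x * p x / Q x))) :
    luxNorm μ (sobolevExponent Q p ε) f ≤ ENNReal.ofReal (l * c.sobolevConst K κ m) := by
  have hT := c.baseConst_nonneg (K + 1)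
  have hC : 0 < c.subcriticalConst K (c.baseConst (K + 1)) κ + c.baseConst (K + 1) :=
    add_pos_of_pos_of_nonneg (one_pos.trans_le (c.one_le_subcriticalConst K hT hκ)) hT
  refine h.luxNorm_sobolevExponent_le (N := m + K + 1) (t := fun x => max 1 (H x : ℝ≥0∞))
    (fun x => hκ.trans_le (hgap x)) hl hC (le_add_of_nonneg_left (by positivity)) ?_ ?_
  · refine (hp.modular_max_one_le h.measurable_p).trans ?_
    rw [hm, show (m : ℝ) + K + 1 = ((m + K + 1 : ℝ≥0) : ℝ) by push_cast; rfl,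
      ENNReal.ofReal_coe_nnreal]
    exact_mod_cast le_self_add
  · filter_upwards [hp.ae_mem] with x hx
    exact (hf x hx).trans_eq (ofReal_mul_max_one_rpow hC.le _ _)

theorem exists_abs_sub_le_rpow [OpensMeasurableSpace X] (hp : HajlaszPair μ p ε K S v H)
    (h : IsRegular c μ Q p ε) (hκ : 0 < κ) (hgap : ∀ x, κ ≤ Q x - ε x * p x) :
    ∃ z : ℝ, ∀ x ∈ S, |v x - z| ≤
      (c.subcriticalConst K (c.baseConst (K + 1)) κ + c.baseConst (K + 1)) *
        max 1 (H x : ℝ) ^ (1 - ε x * p x / Q x) := by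
  rcases isEmpty_or_nonempty X with hX | hX
  · exact ⟨0, fun x => hX.elim x⟩
  obtain ⟨y, hy, hHy⟩ := h.exists_le_baseConst (K := K + 1) hp.measurable
    (hp.modular_le.trans (by exact_mod_cast le_self_add)) hp.ae_mem
  refine ⟨v y, fun x hx => (hp.abs_sub_le_rpow h hκ (hgap x) hx hy hHy).trans ?_⟩
  gcongr
  exact le_add_of_nonneg_right (c.baseConst_nonneg _)

theorem abs_le_rpow [OpensMeasurableSpace X] (hp : HajlaszPair μ p ε K S v H)
    (h : IsRegular c μ Q p ε) (hκ : 0 < κ) (hgap : ∀ x, κ ≤ Q x - ε x * p x)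
    (hv : Measurable v) (hmod : modular μ p (fun x => ‖v x‖ₑ) ≤ 1) {x : X} (hx : x ∈ S) :
    |v x| ≤ (c.subcriticalConst K (c.baseConst (K + 1)) κ + c.baseConst (K + 1)) *
      max 1 (H x : ℝ) ^ (1 - ε x * p x / Q x) := by
  have : Nonempty X := ⟨x⟩
  obtain ⟨y, hy, hy_le⟩ := h.exists_le_baseConst (K := K + 1) (F := fun x => max (H x) ‖v x‖₊)
    (hp.measurable.max hv.nnnorm) (by
      simp only [ENNReal.coe_max]
      exact (modular_max_le h.measurable_p hp.measurable.coe_nnreal_ennreal _).trans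
        (add_le_add hp.modular_le hmod)) hp.ae_mem
  rw [NNReal.coe_max, max_le_iff, coe_nnnorm, Real.norm_eq_abs] at hy_le
  have one_le : 1 ≤ max 1 (H x : ℝ) ^ (1 - ε x * p x / Q x) := by
    refine Real.one_le_rpow (le_max_left _ _) ?_
    rw [sub_nonneg, div_le_one (h.Q_pos x)]
    linarith [hgap x]
  calc |v x| ≤ |v x - v y| + |v y| := by simpa using abs_sub_le (v x) (v y) 0
    _ ≤ c.subcriticalConst K (c.baseConst (K + 1)) κ * max 1 (H x : ℝ) ^ (1 - ε x * p x / Q x) +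
        c.baseConst (K + 1) * max 1 (H x : ℝ) ^ (1 - ε x * p x / Q x) :=
      add_le_add (hp.abs_sub_le_rpow h hκ (hgap x) hx hy hy_le.1)
        (hy_le.2.trans (le_mul_of_one_le_right (c.baseConst_nonneg _) one_le))
    _ = _ := (add_mul _ _ _).symm

end HajlaszPair

end Subcritical

namespace RegularityConstants

variable (c : RegularityConstants) (K : ℝ≥0)

/-- A bound for the average of `max 1 H ^ p` when the modular of `H` is at most `K`. -/
def averageConst : ℝ := 1 + K / (c.b * c.R ^ c.A)

theorem averageConst_pos : 0 < c.averageConst K := by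
  have := c.b_pos
  have := c.R_pos
  unfold averageConst
  positivity

/-- The constant of the logarithmic oscillation estimate relative to a good base point. -/
def logConst : ℝ := c.criticalConst K (c.baseConst K)

theorem logConst_pos : 0 < c.logConst K :=
  one_pos.trans_le (c.one_le_criticalConst K (c.baseConst_nonneg K))

/-- A bound for the distance between the average and the value at a good base point, when
`ε p = Q`. -/
def averageOscConst : ℝ := c.logConst K * (1 + 1 / c.a) * c.averageConst K

theorem averageOscConst_pos : 0 < c.averageOscConst K := by
  have := c.a_pos
  have := c.logConst_pos K
  have := c.averageConst_pos K
  unfold averageOscConst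
  positivity

/-- The bound for the exponential average in the Moser–Trudinger inequality. -/
def expConst : ℝ :=
  Real.exp (c.a / c.logConst K * (c.logConst K + c.averageOscConst K)) * c.averageConst K

theorem expConst_pos : 0 < c.expConst K := mul_pos (Real.exp_pos _) (c.averageConst_pos K)

end RegularityConstants

section Critical

variable {X : Type*} [PseudoMetricSpace X] [MeasurableSpace X] {c : RegularityConstants}
  {μ : Measure X} {Q p ε : X → ℝ} {K : ℝ≥0} {S : Set X} {v : X → ℝ} {H : X → ℝ≥0}

theorem IsRegular.ofReal_le_measure_univ [Nonempty X] (h : IsRegular c μ Q p ε) :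
    ENNReal.ofReal (c.b * c.R ^ c.A) ≤ μ univ := by
  obtain ⟨x⟩ := ‹Nonempty X›
  have := c.b_pos
  have := c.R_pos
  have := c.R_le_one
  calc ENNReal.ofReal (c.b * c.R ^ c.A) ≤ ENNReal.ofReal (c.b * c.R ^ Q x) := by
        gcongr ENNReal.ofReal (_ * ?_)
        exact Real.rpow_le_rpow_of_exponent_ge c.R_pos c.R_le_one (h.Q_mem x).2
    _ ≤ μ (Metric.ball x c.R) := h.lower_regular x _ c.R_pos le_rfl
    _ ≤ μ univ := measure_mono (subset_univ _)

theorem IsRegular.neZero [Nonempty X] (h : IsRegular c μ Q p ε) : NeZero μ := by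
  have : 0 < c.b * c.R ^ c.A := mul_pos c.b_pos (Real.rpow_pos_of_pos c.R_pos _)
  exact ⟨Measure.measure_univ_ne_zero.1
    ((ENNReal.ofReal_pos.2 this).trans_le h.ofReal_le_measure_univ).ne'⟩

theorem IsRegular.measure_univ_add_le [Nonempty X] (h : IsRegular c μ Q p ε) :
    μ univ + K ≤ ENNReal.ofReal (c.averageConst K) * μ univ := by
  have := c.b_pos
  have := c.R_pos
  have volume_pos : 0 < c.b * c.R ^ c.A := by positivity
  rw [RegularityConstants.averageConst, ENNReal.ofReal_add zero_le_one (by positivity),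
    ENNReal.ofReal_one, add_mul, one_mul]
  gcongr
  calc (K : ℝ≥0∞)
      = ENNReal.ofReal (K / (c.b * c.R ^ c.A)) * ENNReal.ofReal (c.b * c.R ^ c.A) := by
        rw [← ENNReal.ofReal_mul (by positivity), div_mul_cancel₀ _ volume_pos.ne',
          ENNReal.ofReal_coe_nnreal]
    _ ≤ _ := by
        gcongr
        exact h.ofReal_le_measure_univ

theorem one_add_log_le_rpow {a t r : ℝ} (ha : 0 < a) (hr : a ≤ r) (ht : 1 ≤ t) :
    1 + Real.log t ≤ (1 + 1 / a) * t ^ r := by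
  have rpow_le : t ^ a ≤ t ^ r := Real.rpow_le_rpow_of_exponent_le ht hr
  calc 1 + Real.log t ≤ t ^ a + t ^ a / a :=
        add_le_add (Real.one_le_rpow ht ha.le) (Real.log_le_rpow_div (zero_le_one.trans ht) ha)
    _ = (1 + 1 / a) * t ^ a := by ring
    _ ≤ (1 + 1 / a) * t ^ r := by gcongr

theorem exp_mul_le_mul_rpow {a B C d r t : ℝ} (ha : 0 < a) (hC : 0 < C) (hr : a ≤ r)
    (ht : 1 ≤ t) (hd : d ≤ C * (1 + Real.log t) + B) :
    Real.exp (a / C * d) ≤ Real.exp (a / C * (C + B)) * t ^ r := by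
  calc Real.exp (a / C * d) ≤ Real.exp (a / C * (C * (1 + Real.log t) + B)) := by gcongr
    _ = Real.exp (a / C * (C + B)) * t ^ a := by
        rw [Real.rpow_def_of_pos (one_pos.trans_le ht), ← Real.exp_add]
        congr 1
        field_simp
        ring
    _ ≤ Real.exp (a / C * (C + B)) * t ^ r := by gcongr

namespace HajlaszPair

theorem lintegral_ofReal_le [Nonempty X] (hp : HajlaszPair μ p ε K S v H)
    (h : IsRegular c μ Q p ε) {f : X → ℝ} {C : ℝ} (hC : 0 ≤ C)
    (hf : ∀ x ∈ S, f x ≤ C * max 1 (H x : ℝ) ^ p x) :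
    ∫⁻ x, ENNReal.ofReal (f x) ∂μ ≤ ENNReal.ofReal (C * c.averageConst K) * μ univ := by
  calc ∫⁻ x, ENNReal.ofReal (f x) ∂μ
      ≤ ∫⁻ x, ENNReal.ofReal C * max 1 (H x : ℝ≥0∞) ^ p x ∂μ := by
        refine lintegral_mono_ae ?_
        filter_upwards [hp.ae_mem] with x hx
        rw [← ofReal_mul_max_one_rpow hC]
        exact ENNReal.ofReal_le_ofReal (hf x hx)
    _ = ENNReal.ofReal C * modular μ p (fun x => max 1 (H x : ℝ≥0∞)) :=
        lintegral_const_mul' _ _ ENNReal.ofReal_ne_top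
    _ ≤ ENNReal.ofReal C * (ENNReal.ofReal (c.averageConst K) * μ univ) := by
        gcongr
        exact (hp.modular_max_one_le h.measurable_p).trans h.measure_univ_add_le
    _ = ENNReal.ofReal (C * c.averageConst K) * μ univ := by
        rw [ENNReal.ofReal_mul hC, mul_assoc]

theorem exists_abs_sub_le_log [OpensMeasurableSpace X] [Nonempty X]
    (hp : HajlaszPair μ p ε K S v H) (h : IsRegular c μ Q p ε) (hcrit : ∀ x, ε x * p x = Q x) :
    ∃ z : ℝ, ∀ x ∈ S, |v x - z| ≤ c.logConst K * (1 + Real.log (max 1 (H x))) := by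
  obtain ⟨y, hy, hHy⟩ := h.exists_le_baseConst hp.measurable hp.modular_le hp.ae_mem
  exact ⟨v y, fun x hx => hp.abs_sub_le_log h (hcrit x) hx hy hHy⟩

theorem lintegral_enorm_sub_le [Nonempty X] (hp : HajlaszPair μ p ε K S v H)
    (h : IsRegular c μ Q p ε) {z : ℝ}
    (hz : ∀ x ∈ S, |v x - z| ≤ c.logConst K * (1 + Real.log (max 1 (H x)))) :
    ∫⁻ x, ‖v x - z‖ₑ ∂μ ≤ ENNReal.ofReal (c.averageOscConst K) * μ univ := by
  have ha := c.a_pos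
  have hC := c.logConst_pos K
  simp only [Real.enorm_eq_ofReal_abs]
  refine hp.lintegral_ofReal_le h (by positivity) fun x hx => (hz x hx).trans ?_
  rw [mul_assoc]
  gcongr
  exact one_add_log_le_rpow ha (h.p_mem x).1 (le_max_left _ _)

theorem integrable_of_critical [OpensMeasurableSpace X] (hp : HajlaszPair μ p ε K S v H)
    (h : IsRegular c μ Q p ε) (hcrit : ∀ x, ε x * p x = Q x) (hv : AEStronglyMeasurable v μ) :
    Integrable v μ := by
  rcases isEmpty_or_nonempty X with hX | hX
  · rw [Measure.eq_zero_of_isEmpty μ]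
    exact integrable_zero_measure
  have := h.isFiniteMeasure
  obtain ⟨z, hz⟩ := hp.exists_abs_sub_le_log h hcrit
  exact integrable_of_lintegral_enorm_sub_le hv (hp.lintegral_enorm_sub_le h hz)

theorem laverage_exp_le [OpensMeasurableSpace X] (hp : HajlaszPair μ p ε K S v H)
    (h : IsRegular c μ Q p ε) (hcrit : ∀ x, ε x * p x = Q x) (hv : AEStronglyMeasurable v μ) :
    ⨍⁻ x, ENNReal.ofReal (Real.exp (c.a / c.logConst K * |v x - ⨍ y, v y ∂μ|)) ∂μ ≤
      ENNReal.ofReal (c.expConst K) := by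
  rcases isEmpty_or_nonempty X with hX | hX
  · rw [Measure.eq_zero_of_isEmpty μ, laverage_zero_measure]
    positivity
  have := h.isFiniteMeasure
  have : NeZero μ := h.neZero
  obtain ⟨z, hz⟩ := hp.exists_abs_sub_le_log h hcrit
  have average_le := abs_average_sub_le (c.averageOscConst_pos K).le
    (hp.integrable_of_critical h hcrit hv) (hp.lintegral_enorm_sub_le h hz)
  rw [laverage_eq]
  refine ENNReal.div_le_of_le_mul (hp.lintegral_ofReal_le h (Real.exp_pos _).le fun x hx => ?_)
  refine exp_mul_le_mul_rpow c.a_pos (c.logConst_pos K) (h.p_mem x).1 (le_max_left _ _) ?_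
  rw [abs_sub_comm] at average_le
  exact (abs_sub_le _ z _).trans (add_le_add (hz x hx) average_le)

end HajlaszPair

end Critical

section Extension

variable {X : Type*} [PseudoMetricSpace X] {S : Set X} {f α : X → ℝ} {C c : ℝ}

theorem uniformContinuous_restrict_of_abs_sub_le_rpow (hC : 0 ≤ C) (hc : 0 < c)
    (hcα : ∀ x, c ≤ α x) (h : ∀ x ∈ S, ∀ y ∈ S, |f x - f y| ≤ C * dist x y ^ α x) :
    UniformContinuous (S.domRestrict f) := by
  rw [Metric.uniformContinuous_iff]
  refine fun η hη => ⟨min 1 ((η / (C + 1)) ^ (1 / c)), by positivity, fun {x y} hxy => ?_⟩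
  have dist_le_one : dist (x : X) y ≤ 1 := (hxy.trans_le (min_le_left _ _)).le
  have dist_le : dist (x : X) y ≤ (η / (C + 1)) ^ (1 / c) := (hxy.trans_le (min_le_right _ _)).le
  calc dist (f x) (f y) ≤ C * dist (x : X) y ^ α x := h x x.2 y y.2
    _ ≤ C * dist (x : X) y ^ c := by
        gcongr ?_ * ?_
        exact Real.rpow_le_rpow_of_exponent_ge_of_imp dist_nonneg dist_le_one (hcα x)
          fun _ h0 => absurd h0 (hc.trans_le (hcα x)).ne'
    _ ≤ C * ((η / (C + 1)) ^ (1 / c)) ^ c := by gcongr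
    _ = C * (η / (C + 1)) := by
        rw [← Real.rpow_mul (by positivity), one_div_mul_cancel hc.ne', Real.rpow_one]
    _ < η := by
        rw [mul_div_assoc', div_lt_iff₀ (by positivity)]
        nlinarith

theorem exists_continuous_extension (hS : Dense S) (hC : 0 ≤ C) (hc : 0 < c)
    (hα : Continuous α) (hcα : ∀ x, c ≤ α x)
    (h : ∀ x ∈ S, ∀ y ∈ S, |f x - f y| ≤ C * dist x y ^ α x) :
    ∃ w : X → ℝ, Continuous w ∧ (∀ x ∈ S, w x = f x) ∧
      ∀ x y, |w x - w y| ≤ C * dist x y ^ α x := by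
  have uniform_f := uniformContinuous_restrict_of_abs_sub_le_rpow hC hc hcα h
  have inducing := isUniformInducing_val S
  have extension_eq := uniformly_extend_of_ind inducing hS.denseRange_val uniform_f
  have continuous_extension :=
    (uniformContinuous_uniformly_extend inducing hS.denseRange_val uniform_f).continuous
  refine ⟨_, continuous_extension, fun x hx => extension_eq ⟨x, hx⟩, ?_⟩
  refine isClosed_property2 hS.denseRange_val (isClosed_le ?_ ?_) fun x y => ?_
  · exact ((continuous_extension.comp continuous_fst).sub
      (continuous_extension.comp continuous_snd)).abs
  · exact continuous_const.mul (continuous_dist.rpow (hα.comp continuous_fst)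
      fun z => Or.inr (hc.trans_le (hcα z.1)))
  · rw [extension_eq, extension_eq]
    exact h x x.2 y y.2

end Extension

section Embeddings

theorem abs_sub_coe_div_ofReal {t : EReal} (ht : t = t.toReal) (z : ℝ) {l : ℝ} (hl : 0 < l) :
    (t - z).abs / ENNReal.ofReal l = ENNReal.ofReal |t.toReal / l - z / l| := by
  nth_rewrite 1 [ht]
  rw [← EReal.coe_sub, EReal.abs_def, ← ENNReal.ofReal_div_of_pos hl, ← sub_div, abs_div,
    abs_of_pos hl]

theorem abs_div_ofReal {t : EReal} (ht : t = t.toReal) {l : ℝ} (hl : 0 < l) :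
    t.abs / ENNReal.ofReal l = ENNReal.ofReal |t.toReal / l| := by
  simpa using abs_sub_coe_div_ofReal ht 0 hl

theorem le_mul_of_forall_lt_le_mul {F N C : ℝ} (h : ∀ l, N < l → F ≤ l * C) : F ≤ N * C :=
  ge_of_tendsto (x := nhdsWithin N (Ioi N))
    (((continuous_id.mul continuous_const).tendsto N).mono_left nhdsWithin_le_nhds)
    (eventually_mem_nhdsWithin.mono h)

namespace Setting

variable {X : Type u} [MetricSpace X] [MeasurableSpace X] [BorelSpace X] {μ : Measure X}
  {b δ D a A L κ : ℝ} {Q p s ε : X → ℝ} {q : X → ℝ≥0∞} {u : X → EReal} {g : ℤ → X → ℝ≥0∞}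

theorem forall_le_sub_mul (hs : Setting μ b δ D a A L κ Q p s ε) {γ : ℝ}
    (hgap : ∀ᵐ x ∂μ, γ ≤ Q x - ε x * p x) : ∀ x, γ ≤ Q x - ε x * p x :=
  have := hs.isOpenPosMeasure
  forall_le_of_ae_le continuous_const
    (hs.exponent_Q.continuous.sub (hs.exponent_ε.continuous.mul hs.exponent_p.continuous)) hgap

theorem forall_le_mul_sub (hs : Setting μ b δ D a A L κ Q p s ε) {γ : ℝ}
    (hgap : ∀ᵐ x ∂μ, γ ≤ ε x * p x - Q x) : ∀ x, γ ≤ ε x * p x - Q x :=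
  have := hs.isOpenPosMeasure
  forall_le_of_ae_le continuous_const
    ((hs.exponent_ε.continuous.mul hs.exponent_p.continuous).sub hs.exponent_Q.continuous) hgap

theorem iInf_luxNorm_sub_le (hs : Setting μ b δ D a A L κ Q p s ε) (hb : 0 < b) (hδ : 0 < δ)
    (ha : 0 < a) (hκ : 0 < κ) {M : ℝ≥0} (hM : μ univ = M) (hq : IsExponent μ q)
    (hgap : ∀ᵐ x ∂μ, κ ≤ Q x - ε x * p x) (hu : MeasFiniteAE μ u)
    (hg : IsVectorGradient μ s u g) (hmem : MemMixed μ p q g) :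
    ⨅ z : ℝ, luxNorm μ (sobolevExponent Q p ε) (fun x => (u x - z).abs) ≤
      ENNReal.ofReal ((settingConstants hb hδ ha D A L).sobolevConst
        (gradientModularConst D a A κ) κ M) * mixedNorm μ p q g := by
  have hreg := hs.isRegular hb hδ ha
  have gap_le := hs.forall_le_sub_mul hgap
  obtain ⟨S, hS, hpair⟩ := hs.exists_hajlaszPair ha hκ hq hu hg hmem
  refine le_ofReal_mul_of_forall_lt (RegularityConstants.sobolevConst_pos _ _ hκ M) fun l hl => ?_
  have hl0 : 0 < l := ENNReal.ofReal_pos.1 (bot_le.trans_lt hl)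
  obtain ⟨H, hp⟩ := hpair l hl
  obtain ⟨z, hz⟩ := hp.exists_abs_sub_le_rpow hreg hκ gap_le
  refine (iInf_le _ (l * z)).trans (hp.luxNorm_le_sobolevConst hreg hκ gap_le hM hl0
    fun x hx => ?_)
  rw [abs_sub_coe_div_ofReal (hS x hx) _ hl0, mul_div_cancel_left₀ _ hl0.ne']
  exact ENNReal.ofReal_le_ofReal (hz x hx)

theorem luxNorm_sobolevExponent_le (hs : Setting μ b δ D a A L κ Q p s ε) (hb : 0 < b) (hδ : 0 < δ)
    (ha : 0 < a) (hκ : 0 < κ) {M : ℝ≥0} (hM : μ univ = M) (hq : IsExponent μ q)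
    (hgap : ∀ᵐ x ∂μ, κ ≤ Q x - ε x * p x) (hu : MeasFiniteAE μ u)
    (hg : IsVectorGradient μ s u g) (hmem : MemMixed μ p q g) :
    luxNorm μ (sobolevExponent Q p ε) (fun x => (u x).abs) ≤
      ENNReal.ofReal ((settingConstants hb hδ ha D A L).sobolevConst
        (gradientModularConst D a A κ) κ M) *
          (luxNorm μ p (fun x => (u x).abs) + mixedNorm μ p q g) := by
  have hreg := hs.isRegular hb hδ ha
  have gap_le := hs.forall_le_sub_mul hgap
  obtain ⟨S, hS, hpair⟩ := hs.exists_hajlaszPair ha hκ hq hu hg hmem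
  refine le_ofReal_mul_of_forall_lt (RegularityConstants.sobolevConst_pos _ _ hκ M) fun l hl => ?_
  have hl0 : 0 < l := ENNReal.ofReal_pos.1 (bot_le.trans_lt hl)
  obtain ⟨H, hp⟩ := hpair l (le_add_self.trans_lt hl)
  have modular_le_one : modular μ p (fun x => ‖(u x).toReal / l‖ₑ) ≤ 1 := by
    refine (modular_mono hs.exponent_p.pos ?_).trans
      (modular_div_le_one_of_luxNorm_lt hs.exponent_p.pos (le_self_add.trans_lt hl))
    filter_upwards [hp.ae_mem] with x hx
    rw [abs_div_ofReal (hS x hx) hl0, Real.enorm_eq_ofReal_abs]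
  refine hp.luxNorm_le_sobolevConst hreg hκ gap_le hM hl0 fun x hx => ?_
  rw [abs_div_ofReal (hS x hx) hl0]
  exact ENNReal.ofReal_le_ofReal (hp.abs_le_rpow hreg hκ gap_le
    (hu.1.ereal_toReal.div_const l) modular_le_one hx)

theorem integrable_and_laverage_exp_le (hs : Setting μ b δ D a A L κ Q p s ε) (hb : 0 < b)
    (hδ : 0 < δ) (ha : 0 < a) (hκ : 0 < κ) (hq : IsExponent μ q) (hcrit : ∀ x, ε x * p x = Q x)
    (hu : MeasFiniteAE μ u) (hg : IsVectorGradient μ s u g) (hmem : MemMixed μ p q g)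
    (hpos : 0 < mixedNorm μ p q g) :
    Integrable (fun x => (u x).toReal) μ ∧
      ⨍⁻ x, ENNReal.ofReal (Real.exp (a / (2 * (settingConstants hb hδ ha D A L).logConst
          (gradientModularConst D a A κ)) *
            (|(u x).toReal - mean μ u| / (mixedNorm μ p q g).toReal))) ∂μ ≤
        ENNReal.ofReal ((settingConstants hb hδ ha D A L).expConst
          (gradientModularConst D a A κ)) := by
  have hreg := hs.isRegular hb hδ ha
  obtain ⟨S, -, hpair⟩ := hs.exists_hajlaszPair ha hκ hq hu hg hmem
  have norm_lt_top := hmem.mixedNorm_lt_top hs.exponent_p.pos hq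
  set N := (mixedNorm μ p q g).toReal
  have hN : 0 < N := ENNReal.toReal_pos hpos.ne' norm_lt_top.ne
  obtain ⟨H, hp⟩ := hpair (2 * N) ((ENNReal.lt_ofReal_iff_toReal_lt norm_lt_top.ne).2
    (lt_two_mul_self hN))
  have measurable_div : AEStronglyMeasurable (fun x => (u x).toReal / (2 * N)) μ :=
    (hu.1.ereal_toReal.div_const _).aestronglyMeasurable
  refine ⟨?_, (laverage_mono_ae (ae_of_all _ fun x => le_of_eq ?_)).trans
    (hp.laverage_exp_le hreg hcrit measurable_div)⟩
  · simpa [div_mul_cancel₀ _ (mul_pos two_pos hN).ne'] using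
      (hp.integrable_of_critical hreg hcrit measurable_div).mul_const (2 * N)
  · have average_div : ⨍ y, (u y).toReal / (2 * N) ∂μ = mean μ u / (2 * N) := integral_div _ _
    rw [average_div, ← sub_div, abs_div, abs_of_pos (mul_pos two_pos hN)]
    congr 2
    change a / (2 * _) * _ = a / _ * _
    field_simp

theorem exists_abs_sub_le (hs : Setting μ b δ D a A L κ Q p s ε) (hb : 0 < b) (hδ : 0 < δ)
    (ha : 0 < a) (hκ : 0 < κ) (hq : IsExponent μ q) (hgap : ∀ x, κ ≤ ε x * p x - Q x)
    (hu : MeasFiniteAE μ u) (hg : IsVectorGradient μ s u g) (hmem : MemMixed μ p q g) :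
    ∃ S : Set X, (∀ᵐ x ∂μ, x ∈ S) ∧ (∀ x ∈ S, u x = ((u x).toReal : EReal)) ∧
      ∀ x ∈ S, ∀ y ∈ S,
        |(u x).toReal - (u y).toReal| ≤ (mixedNorm μ p q g).toReal *
          (settingConstants hb hδ ha D A L).boundConst (gradientModularConst D a A κ) κ ∧
        |(u x).toReal - (u y).toReal| ≤ (mixedNorm μ p q g).toReal *
          ((settingConstants hb hδ ha D A L).holderConst (gradientModularConst D a A κ) κ *
            dist x y ^ (ε x - Q x / p x)) := by
  have hreg := hs.isRegular hb hδ ha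
  obtain ⟨S, hS, hpair⟩ := hs.exists_hajlaszPair ha hκ hq hu hg hmem
  have norm_lt_top := hmem.mixedNorm_lt_top hs.exponent_p.pos hq
  have norm_lt : ∀ l, (mixedNorm μ p q g).toReal < l → mixedNorm μ p q g < ENNReal.ofReal l :=
    fun l => (ENNReal.lt_ofReal_iff_toReal_lt norm_lt_top.ne).2
  obtain ⟨H₁, hp₁⟩ := hpair _ (norm_lt _ (lt_add_one _))
  refine ⟨S, hp₁.ae_mem, hS, fun x hx y hy => ?_⟩
  have scale : ∀ l, (mixedNorm μ p q g).toReal < l → ∀ C,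
      |(u x).toReal / l - (u y).toReal / l| ≤ C → |(u x).toReal - (u y).toReal| ≤ l * C := by
    intro l hl C hC
    have hl0 : 0 < l := ENNReal.toReal_nonneg.trans_lt hl
    rwa [← sub_div, abs_div, abs_of_pos hl0, div_le_iff₀' hl0] at hC
  constructor <;> refine le_mul_of_forall_lt_le_mul fun l hl => scale l hl _ ?_ <;>
    obtain ⟨H, hp⟩ := hpair l (norm_lt l hl)
  · exact hp.abs_sub_le_boundConst hreg hκ hgap hx hy
  · exact hp.abs_sub_le_dist_rpow hreg hκ hgap hx hy

theorem integrable_and_eLpNorm_top_le (hs : Setting μ b δ D a A L κ Q p s ε) (hb : 0 < b)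
    (hδ : 0 < δ) (ha : 0 < a) (hκ : 0 < κ) (hq : IsExponent μ q)
    (hgap : ∀ᵐ x ∂μ, κ ≤ ε x * p x - Q x) (hu : MeasFiniteAE μ u)
    (hg : IsVectorGradient μ s u g) (hmem : MemMixed μ p q g) :
    Integrable (fun x => (u x).toReal) μ ∧
      eLpNorm (fun x => (u x).toReal - mean μ u) ∞ μ ≤
        ENNReal.ofReal ((settingConstants hb hδ ha D A L).boundConst
          (gradientModularConst D a A κ) κ) * mixedNorm μ p q g := by
  have hreg := hs.isRegular hb hδ ha
  have : IsFiniteMeasure μ := hreg.isFiniteMeasure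
  have norm_lt_top := hmem.mixedNorm_lt_top hs.exponent_p.pos hq
  obtain ⟨S, ae_mem, -, hS⟩ :=
    hs.exists_abs_sub_le hb hδ ha hκ hq (hs.forall_le_mul_sub hgap) hu hg hmem
  have hB := zero_le_one.trans ((settingConstants hb hδ ha D A L).one_le_boundConst
    (gradientModularConst D a A κ) hκ)
  set B := (settingConstants hb hδ ha D A L).boundConst (gradientModularConst D a A κ) κ
  have lintegral_le : ∀ y ∈ S, ∫⁻ x, ‖(u x).toReal - (u y).toReal‖ₑ ∂μ ≤
      ENNReal.ofReal ((mixedNorm μ p q g).toReal * B) * μ univ := fun y hy => by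
    rw [← lintegral_const]
    refine lintegral_mono_ae (ae_mem.mono fun x hx => ?_)
    rw [Real.enorm_eq_ofReal_abs]
    exact ENNReal.ofReal_le_ofReal (hS x hx y hy).1
  have integrable_u : Integrable (fun x => (u x).toReal) μ := by
    rcases S.eq_empty_or_nonempty with rfl | ⟨y, hy⟩
    · rw [ae_eq_bot.1 (Filter.eventually_false_iff_eq_bot.1 ae_mem)]
      exact integrable_zero_measure
    · exact integrable_of_lintegral_enorm_sub_le hu.1.ereal_toReal.aestronglyMeasurable
        (lintegral_le y hy)
  refine ⟨integrable_u, ?_⟩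
  rw [eLpNorm_exponent_top, ← ENNReal.ofReal_toReal norm_lt_top.ne, ← ENNReal.ofReal_mul hB,
    mul_comm]
  refine eLpNormEssSup_le_of_ae_bound (ae_mem.mono fun x hx => ?_)
  have : Nonempty X := ⟨x⟩
  have : NeZero μ := hreg.neZero
  rw [Real.norm_eq_abs, abs_sub_comm]
  exact abs_average_sub_le (by positivity) integrable_u (lintegral_le x hx)

theorem exists_continuous_representative (hs : Setting μ b δ D a A L κ Q p s ε) (hb : 0 < b)
    (hδ : 0 < δ) (ha : 0 < a) (hκ : 0 < κ) (hq : IsExponent μ q)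
    (hgap : ∀ᵐ x ∂μ, κ ≤ ε x * p x - Q x) (hu : MeasFiniteAE μ u)
    (hg : IsVectorGradient μ s u g) (hmem : MemMixed μ p q g) :
    ∃ w : X → ℝ, Continuous w ∧ (∀ᵐ x ∂μ, u x = (w x : EReal)) ∧
      ∀ x y, ENNReal.ofReal |w x - w y| ≤
        ENNReal.ofReal ((settingConstants hb hδ ha D A L).holderConst
          (gradientModularConst D a A κ) κ) * mixedNorm μ p q g *
            ENNReal.ofReal (dist x y ^ (ε x - Q x / p x)) := by
  have := hs.isOpenPosMeasure
  have hreg := hs.isRegular hb hδ ha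
  have gap_le := hs.forall_le_mul_sub hgap
  have norm_lt_top := hmem.mixedNorm_lt_top hs.exponent_p.pos hq
  obtain ⟨S, ae_mem, hSu, hS⟩ := hs.exists_abs_sub_le hb hδ ha hκ hq gap_le hu hg hmem
  have hC := zero_le_one.trans ((settingConstants hb hδ ha D A L).one_le_holderConst
    (gradientModularConst D a A κ) hκ)
  obtain ⟨w, continuous_w, w_eq, w_le⟩ := exists_continuous_extension
    (Measure.dense_of_ae ae_mem) (mul_nonneg ENNReal.toReal_nonneg hC)
    (div_pos hκ (settingConstants hb hδ ha D A L).A_pos) hreg.hasLogModulus_sub_div.continuous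
    (fun x => hreg.le_sub_div hκ.le (gap_le x))
    fun x hx y hy => (hS x hx y hy).2.trans_eq (mul_assoc _ _ _).symm
  refine ⟨w, continuous_w, ae_mem.mono fun x hx => by rw [w_eq x hx]; exact hSu x hx,
    fun x y => ?_⟩
  rw [← ENNReal.ofReal_toReal norm_lt_top.ne, ← ENNReal.ofReal_mul hC,
    ← ENNReal.ofReal_mul (by positivity), mul_comm (RegularityConstants.holderConst _ _ _)]
  exact ENNReal.ofReal_le_ofReal (w_le x y)

end Setting

end Embeddings

end VarBesov

end

theorem mainTheorem11 (b δ D a A L κ : ℝ) (hb : 0 < b) (hb1 : b ≤ 1) (hδ : 0 < δ)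
    (ha : 0 < a) (hκ : 0 < κ) :
    -- (i) the case `ε p ≪ Q`
    (∀ M : ℝ≥0, ∃ C : ℝ, 0 < C ∧
      ∀ (X : Type u) [MetricSpace X] [MeasurableSpace X] [BorelSpace X] (μ : Measure X)
        (Q p s ε : X → ℝ) (q : X → ℝ≥0∞),
        Setting μ b δ D a A L κ Q p s ε → μ univ = M → IsExponent μ q →
        (∀ᵐ x ∂μ, κ ≤ Q x - ε x * p x) →
        (∀ (u : X → EReal) (g : ℤ → X → ℝ≥0∞), MemHomBesov μ s p q u →
          IsVectorGradient μ s u g → MemMixed μ p q g →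
          ⨅ c : ℝ, luxNorm μ (fun x => Q x * p x / (Q x - ε x * p x))
              (fun x => (u x - (c : EReal)).abs)
            ≤ ENNReal.ofReal C * mixedNorm μ p q g) ∧
        (∀ (u : X → EReal) (g : ℤ → X → ℝ≥0∞), MemBesov μ s p q u →
          IsVectorGradient μ s u g → MemMixed μ p q g →
          luxNorm μ (fun x => Q x * p x / (Q x - ε x * p x)) (fun x => (u x).abs)
            ≤ ENNReal.ofReal C *
              (luxNorm μ p (fun x => (u x).abs) + mixedNorm μ p q g))) ∧
    -- (ii) the case `ε p = Q`
    (∃ C₁ C₂ : ℝ, 0 < C₁ ∧ 0 < C₂ ∧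
      ∀ (X : Type u) [MetricSpace X] [MeasurableSpace X] [BorelSpace X] (μ : Measure X)
        (Q p s ε : X → ℝ) (q : X → ℝ≥0∞),
        Setting μ b δ D a A L κ Q p s ε → IsExponent μ q →
        (∀ x, ε x * p x = Q x) →
        ∀ (u : X → EReal) (g : ℤ → X → ℝ≥0∞), MemHomBesov μ s p q u →
          IsVectorGradient μ s u g → MemMixed μ p q g → 0 < mixedNorm μ p q g →
          Integrable (fun x => (u x).toReal) μ ∧
          ⨍⁻ x, ENNReal.ofReal
              (Real.exp (C₁ * (|(u x).toReal - mean μ u| / (mixedNorm μ p q g).toReal))) ∂μ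
            ≤ ENNReal.ofReal C₂) ∧
    -- (iii) the case `ε p ≫ Q`
    (∃ C₁ C₂ : ℝ, 0 < C₁ ∧ 0 < C₂ ∧
      ∀ (X : Type u) [MetricSpace X] [MeasurableSpace X] [BorelSpace X] (μ : Measure X)
        (Q p s ε : X → ℝ) (q : X → ℝ≥0∞),
        Setting μ b δ D a A L κ Q p s ε → IsExponent μ q →
        (∀ᵐ x ∂μ, κ ≤ ε x * p x - Q x) →
        ∀ (u : X → EReal) (g : ℤ → X → ℝ≥0∞), MemHomBesov μ s p q u →
          IsVectorGradient μ s u g → MemMixed μ p q g →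
          Integrable (fun x => (u x).toReal) μ ∧
          eLpNorm (fun x => (u x).toReal - mean μ u) ∞ μ
            ≤ ENNReal.ofReal C₁ * mixedNorm μ p q g ∧
          ∃ v : X → ℝ, Continuous v ∧ (∀ᵐ x ∂μ, u x = (v x : EReal)) ∧
            ∀ x y, ENNReal.ofReal |v x - v y| ≤
              ENNReal.ofReal C₂ * mixedNorm μ p q g *
                ENNReal.ofReal (dist x y ^ (ε x - Q x / p x))) := by
  refine ⟨fun M => ⟨(settingConstants hb hδ ha D A L).sobolevConst
      (gradientModularConst D a A κ) κ M, RegularityConstants.sobolevConst_pos _ _ hκ M, ?_⟩,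
    ⟨a / (2 * (settingConstants hb hδ ha D A L).logConst (gradientModularConst D a A κ)),
      (settingConstants hb hδ ha D A L).expConst (gradientModularConst D a A κ),
      div_pos ha (mul_pos two_pos (RegularityConstants.logConst_pos _ _)),
      RegularityConstants.expConst_pos _ _, ?_⟩,
    ⟨(settingConstants hb hδ ha D A L).boundConst (gradientModularConst D a A κ) κ,
      (settingConstants hb hδ ha D A L).holderConst (gradientModularConst D a A κ) κ,
      one_pos.trans_le (RegularityConstants.one_le_boundConst _ _ hκ),
      one_pos.trans_le (RegularityConstants.one_le_holderConst _ _ hκ), ?_⟩⟩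
  · intro X _ _ _ μ Q p s ε q hs hM hq hgap
    exact ⟨fun u g hu hg hmem => hs.iInf_luxNorm_sub_le hb hδ ha hκ hM hq hgap hu.1 hg hmem,
      fun u g hu hg hmem => hs.luxNorm_sobolevExponent_le hb hδ ha hκ hM hq hgap hu.1.1 hg hmem⟩
  · intro X _ _ _ μ Q p s ε q hs hq hcrit u g hu hg hmem hpos
    exact hs.integrable_and_laverage_exp_le hb hδ ha hκ hq hcrit hu.1 hg hmem hpos
  · intro X _ _ _ μ Q p s ε q hs hq hgap u g hu hg hmem
    have morrey := hs.integrable_and_eLpNorm_top_le hb hδ ha hκ hq hgap hu.1 hg hmem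
    exact ⟨morrey.1, morrey.2, hs.exists_continuous_representative hb hδ ha hκ hq hgap hu.1 hg hmem⟩
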